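/- Throughout, $\log x$ stands for $\max\{1,\log_2 x\}$. A radio network of size $n$ is a directed graph $G$ on the node set $\{1,\dots,n\}$ (the identifiers) with a source from which every node is reachable; its eccentricity $D$ is the maximum directed distance from the source to a node, and $\Delta$ is its maximum in-degree. Time is divided into synchronous steps. In each step an active node either transmits to all its out-neighbours or listens, and a listening node receives a message if and only if exactly one of its in-neighbours transmits (otherwise it receives nothing; there is no collision detection). The source is active from step $0$; every other node is dormant and silent until it first receives a transmission, and if this happens in step $i-1$, it becomes active in step $i$. Every transmission carries the source message and possibly additional control information, such as the current time. A deterministic protocol determines what a node does from $n$, $D$, $\Delta$, the node's identifier and what the node has heard so far; the nodes know nothing else about the network and have no global clock. Broadcasting is completed when all nodes are active. For integers $B\ge 1$ and $x\ge 0$ let $\mu_B(x)$ be $x$ rounded up to a multiple of $B$. Binary sequences $S^v=(S^v_0,S^v_1,\dots)$, $v\in\{1,\dots,n\}$, form an $(n,\Delta,r,B)$-block synchronizer if for every $\omega:\{1,\dots,n\}\to\mathbb{N}$ and every nonempty $X\subseteq\{1,\dots,n\}$ with $|X|\le\Delta$ there is an integer $j$ with $s(X)\le j<s(X)+B\lceil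 |X|/r\rceil$ and $\sum_{v\in X}S^v_{j-s(v)}=1$, where $s(v)=\mu_B(\omega(v))$, $s(X)=\mu_B(\min_{v\in X}\omega(v))$, and $S^v_k=0$ for $k<0$. Given such sequences with $r=n/D$, the block synchronizer algorithm is: a node $v$ that becomes active in step $i$ transmits in step $\mu_B(i)+j$, for $j=0,\dots,DB-1$, if and only if $S^v_j=1$. **Theorem.** There are absolute constants $c,C>0$ such that the following holds for all integers $n,D,\Delta\ge 0$. (1) If $D,\Delta\le n<D\Delta$ and $B=\left\lceil c\,\frac nD\log D\,\log\log\frac{D\Delta}{n}\right\rceil$, then $(n,\Delta,\frac nD,B)$-block synchronizers exist, and with every such block synchronizer the block synchronizer algorithm completes broadcasting in every radio network of size $n$, eccentricity $D$ and maximum in-degree $\Delta$ within $C\,n\log D\,\log\log\frac{D\Delta}{n}$ time steps. (2) If $D\Delta\le n$, then there is a deterministic protocol that completes broadcasting in every radio network of size $n$, eccentricity $D$ and maximum in-degree $\Delta$ within $C\,D\Delta\log\frac n\Delta$ time steps, and also within $C\,n\log D\,\log\log\frac{D\Delta}{n}$ time steps. (For $n=0$ or $\Delta=0$ a quotient with denominator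 $0$ is read as $0$.) -/

import Mathlib

/-- The logarithm in all running times: `log₂ x`, but never below `1`. -/
noncomputable def lg (x : ℝ) : ℝ := max 1 (Real.logb 2 x)

namespace Radio

/-! ### Networks

The nodes of a network of size `n` are identified with their identifiers, so the node set is
`Fin n`.  `G.Adj u v` means that `u` can send directly to `v`. -/

/-- There is a directed walk with exactly `k` edges from `u` to `v`. -/
def HasWalk {n : ℕ} (G : Digraph (Fin n)) : ℕ → Fin n → Fin n → Prop
  | 0, u, v => u = v
  | k + 1, u, v => ∃ w, HasWalk G k u w ∧ G.Adj w v

/-- The directed distance from `u` to `v` (meaningful when `v` is reachable from `u`). -/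
noncomputable def dist {n : ℕ} (G : Digraph (Fin n)) (u v : Fin n) : ℕ :=
  sInf {k | HasWalk G k u v}

/-- The eccentricity: the maximum distance from the source to any node. -/
noncomputable def ecc {n : ℕ} (G : Digraph (Fin n)) (source : Fin n) : ℕ :=
  Finset.univ.sup fun v => dist G source v

/-- The number of in-neighbours of `v`. -/
noncomputable def inDegree {n : ℕ} (G : Digraph (Fin n)) (v : Fin n) : ℕ :=
  {u | G.Adj u v}.ncard

/-- The maximum in-degree. -/
noncomputable def maxInDegree {n : ℕ} (G : Digraph (Fin n)) : ℕ :=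
  Finset.univ.sup fun v => inDegree G v

/-- `G` with the given source is a network of eccentricity `D` and maximum in-degree `Δ` in which
every node is reachable from the source. -/
structure IsNetwork {n : ℕ} (G : Digraph (Fin n)) (source : Fin n) (D Δ : ℕ) : Prop where
  reachable : ∀ v, ∃ k, HasWalk G k source v
  ecc_eq : ecc G source = D
  maxInDegree_eq : maxInDegree G = Δ

/-! ### Deterministic broadcasting protocols without collision detection

Every transmission carries the source message, together with additional control information,
encoded as a natural number.  There is no global clock: a node acts on its own identifier and on
what it has heard since it became active, and on nothing else. -/

/-- What a node has heard since it became active, one entry for every time-step, the most recent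
first: `some a` if it received a transmission with control information `a`, and `none` if it
received nothing.  The history is empty as long as the node is dormant.  For a node other than the
source the oldest entry is the first transmission that it received; the oldest entry at the source
is the control information with which it is started. -/
abbrev History := List (Option ℕ)

/-- A deterministic broadcasting protocol for nodes with identifiers in `Fin n`. -/
structure Protocol (n : ℕ) where
  /-- the control information with which the source is started -/
  start : ℕ
  /-- `send v h` is what node `v` with history `h` does in the current time-step: it listens
  (`none`), or it transmits the source message with control information `a` (`some a`) -/
  send : Fin n → History → Option ℕ

/-- What a node with history `h` does: dormant nodes remain silent. -/
def Protocol.action {n : ℕ} (P : Protocol n) (v : Fin n) (h : History) : Option ℕ :=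
  if h = [] then none else P.send v h

open Classical in
/-- What node `v` receives in a time-step in which each node `u` does `act u`: if `v` listens and
exactly one of its in-neighbours transmits, the transmission of that in-neighbour, and nothing in
all other cases. -/
noncomputable def receive {n : ℕ} (G : Digraph (Fin n)) (act : Fin n → Option ℕ) (v : Fin n) :
    Option ℕ :=
  if h : act v = none ∧ ∃! u, G.Adj u v ∧ act u ≠ none then act h.2.choose else none

/-- The history of node `v` at the beginning of time-step `t`.  The source is active from
time-step `0` on; every other node becomes active in the time-step after the one in which it
received its first transmission. -/
noncomputable def Protocol.history {n : ℕ} (P : Protocol n) (G : Digraph (Fin n))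
    (source : Fin n) : ℕ → Fin n → History
  | 0, v => if v = source then [some P.start] else []
  | t + 1, v =>
      let old := P.history G source t
      let heard := receive G (fun u => P.action u (old u)) v
      if old v = [] ∧ heard = none then [] else heard :: old v

/-- After at most `b` time-steps of `P` all nodes are active, that is, know the source message. -/
def Protocol.BroadcastsWithin {n : ℕ} (P : Protocol n) (G : Digraph (Fin n)) (source : Fin n)
    (b : ℝ) : Prop :=
  ∃ T : ℕ, (T : ℝ) ≤ b ∧ ∀ v, P.history G source T v ≠ []

/-! ### Block synchronizers -/

/-- `x` rounded up to the next multiple of `B`. -/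
def blockStart (B x : ℕ) : ℕ := (x ⌈/⌉ B) * B

/-- The binary sequences `S v` form an `(n, Δ, r, B)`-block synchronizer: for every activation
schedule `ω` and every nonempty set `X` of at most `Δ` elements there is a column `j` with
`s(X) ≤ j < s(X) + B ⌈|X| / r⌉` such that exactly one `v ∈ X` has a `1` in place `j - s(v)` of its
sequence.  Here `s(v)` and `s(X)` are `ω(v)` and `min_{v ∈ X} ω(v)`, rounded up to multiples of
`B`; elements with `s(v) > j` have not started and do not count. -/
def IsBlockSynchronizer (n Δ : ℕ) (r : ℝ) (B : ℕ) (S : Fin n → ℕ → Bool) : Prop :=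
  ∀ (ω : Fin n → ℕ) (X : Finset (Fin n)) (hX : X.Nonempty), X.card ≤ Δ →
    ∃ j : ℕ, blockStart B (X.inf' hX ω) ≤ j ∧
      j < blockStart B (X.inf' hX ω) + B * ⌈(X.card : ℝ) / r⌉₊ ∧
      (X.filter fun v => blockStart B (ω v) ≤ j ∧
        S v (j - blockStart B (ω v)) = true).card = 1

/-- The block length `c (n / D) log D log log (D Δ / n)`, rounded up to an integer. -/
noncomputable def blockLength (c : ℝ) (n D Δ : ℕ) : ℕ :=
  ⌈c * ((n : ℝ) / D) * lg D * lg (lg ((D : ℝ) * Δ / n))⌉₊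

/-- The block synchronizer algorithm with block length `B` and sequences `S`.  A node `v` that
becomes active in time-step `i` transmits in time-step `blockStart B i + j`, for `0 ≤ j < D * B`,
if and only if `S v j = 1`.  The control information of a transmission is the time-step in which
its receivers become active; a node thus learns `i` from the first transmission that it receives,
and it computes the current time-step `t` from `i` and from the length of its history. -/
def blockAlgorithm (n D B : ℕ) (S : Fin n → ℕ → Bool) : Protocol n where
  start := 0
  send v h :=
    match h.getLast? with
    | some (some i) =>
        let t := i + (h.length - 1)
        if blockStart B i ≤ t ∧ t < blockStart B i + D * B ∧ S v (t - blockStart B i) = true then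
          some (t + 1)
        else none
    | _ => none

end Radio

/-!
# Block synchronizers and broadcasting

**Selective families.**  A column of independent random bits isolates an element (that is, has
exactly one `1`) with constant probability if the expected number of `1`s is between `1 / 4` and
`1 / 2`.  A union bound (`exists_forall_exists_card_filter_eq_one`) over all sets of between `x / 2`
and `x` elements, with probabilities `1 / (2 x)`, and a halving of `x` yield selective families with
`O(x log (n / x))` places (`exists_isSelective`).

**Block synchronizers.**  Let `r = n / D`.  A block starts with a selective family for sets of at
most `r` elements, obeyed only by those elements that have just started.  In the rest of the
block an element of age `k` (in blocks) has a `1` with probability `2 ^ (-q) / (r (k + 1))`, for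
scales `q = 1, …, O(log log (Δ / r))` which all elements use simultaneously, because they start at
multiples of the block length.  Given `X`, consider the first block `i` in which at most `r (i + 1)`
elements have started.  If `i = 0`, the selective family isolates an element.  Otherwise each
block `j < i` has a load `∑ 1 / (r (k + 1))` of at least `1`; the loads add up to
`O(i log i)`, so that half of the blocks have loads between `1` and `O(log (Δ / r))` and hence a
scale that isolates an element with constant probability in each of its `Θ(r log D)` columns.  Only
the schedules of the at most `r (i + 1)` started elements matter, and there are only
`D ^ O(r i)` of these, so a union bound applies (`exists_hits_heavy_schedules`,
`exists_isBlockSynchronizer`).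

**Broadcasting.**  Follow a path `p 0, …, p d` from the source, and let `X l` be the set of nodes
whose last out-neighbour on the path is `p l`.  As soon as a node of `X l` is active, within
`B (⌈|X l| / r⌉ + 1)` steps some node of a later `X l'` is, or the end of the path.  Since the `X l`
are disjoint, this adds up to `3 D B` steps (`blockAlgorithm_synchronizer_history`).  For `D Δ ≤ n`
the nodes just repeat a selective family for sets of at most `Δ` elements in blocks of its length;
every block informs a further layer (`blockAlgorithm_selective_history`), and
`D Δ log (n / Δ) = O(n log D)` (`mul_lg_div_le`).
-/

/-! ### Isolating random places -/

open MeasureTheory ProbabilityTheory in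
/-- If the expected number of successes among independent trials lies between `1/4` and `1/2`,
then exactly one trial succeeds with probability at least `1/8`. -/
lemma ProbabilityTheory.iIndepFun.le_measure_card_eq_one {Ω ι : Type*} [MeasurableSpace Ω]
    [DecidableEq ι] {μ : Measure Ω} [IsProbabilityMeasure μ] {X : ι → Ω → Bool}
    (hX : iIndepFun X μ)
    (hm : ∀ i, Measurable (X i)) {p : ι → ℝ} (hp : ∀ i, μ.real (X i ⁻¹' {true}) = p i)
    (s : Finset ι) (h₁ : 1 / 4 ≤ ∑ i ∈ s, p i) (h₂ : ∑ i ∈ s, p i ≤ 1 / 2) :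
    1 / 8 ≤ μ.real {ω | (s.filter fun i => X i ω = true).card = 1} := by
  have hp0 : ∀ i, 0 ≤ p i := fun i => by rw [← hp i]; positivity
  have hq : ∀ i, μ.real (X i ⁻¹' {false}) = 1 - p i := fun i => by
    rw [← hp i, ← probReal_compl_eq_one_sub ((hm i) (measurableSet_singleton _))]
    congr 1; ext ω; simp
  -- `A x` is the event that `x` is the only success
  set A : ι → Set Ω := fun x => ⋂ i ∈ s, X i ⁻¹' {decide (i = x)} with hA
  have hAm : ∀ x, MeasurableSet (A x) := fun x =>
    Finset.measurableSet_biInter _ fun i _ => (hm i) (measurableSet_singleton _)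
  have hAμ : ∀ x ∈ s, p x * (1 / 2) ≤ μ.real (A x) := by
    intro x hx
    have h := hX.measure_inter_preimage_eq_mul s
      (sets := fun i => {decide (i = x)}) (fun i _ => measurableSet_singleton _)
    have h' : μ.real (A x) = ∏ i ∈ s, μ.real (X i ⁻¹' {decide (i = x)}) := by
      simp only [measureReal_def, ← ENNReal.toReal_prod]
      rw [← h]
    rw [h', ← Finset.mul_prod_erase s _ hx]
    have e1 : ∏ i ∈ s.erase x, μ.real (X i ⁻¹' {decide (i = x)})
        = ∏ i ∈ s.erase x, (1 - p i) := by
      refine Finset.prod_congr rfl fun i hi => ?_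
      rw [decide_eq_false (Finset.ne_of_mem_erase hi), hq]
    rw [e1]
    simp only [decide_true, hp]
    refine mul_le_mul_of_nonneg_left ?_ (hp0 x)
    have hW : ∀ t : Finset ι, 1 - ∑ i ∈ t, p i ≤ ∏ i ∈ t, (1 - p i) := by
      intro t
      induction t using Finset.induction_on with
      | empty => simp
      | insert a t ha ih =>
        rw [Finset.sum_insert ha, Finset.prod_insert ha]
        have h1 : p a ≤ 1 := by rw [← hp a]; exact measureReal_le_one
        have h2 : ∏ i ∈ t, (1 - p i) ≤ 1 := by
          refine Finset.prod_le_one (fun i _ => ?_) (fun i _ => ?_)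
          · rw [← hq]; positivity
          · linarith [hp0 i]
        nlinarith [hp0 a]
    have := hW (s.erase x)
    have h3 : ∑ i ∈ s.erase x, p i ≤ ∑ i ∈ s, p i :=
      Finset.sum_le_sum_of_subset_of_nonneg (Finset.erase_subset _ _) fun i _ _ => hp0 i
    linarith
  have hsub : (⋃ x ∈ s, A x) ⊆ {ω | (s.filter fun i => X i ω = true).card = 1} := by
    intro ω hω
    simp only [Set.mem_iUnion, hA, Set.mem_iInter, Set.mem_preimage, Set.mem_singleton_iff] at hω
    obtain ⟨x, hx, h⟩ := hω
    refine Finset.card_eq_one.2 ⟨x, ?_⟩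
    ext i
    simp only [Finset.mem_filter, Finset.mem_singleton]
    constructor
    · rintro ⟨hi, h1⟩; simpa [h i hi] using h1
    · rintro rfl; exact ⟨hx, by simp [h i hx]⟩
  have hdisj : Set.PairwiseDisjoint (↑s) A := by
    intro x hx y hy hxy
    refine Set.disjoint_left.2 fun ω h1 h2 => hxy ?_
    simp only [hA, Set.mem_iInter, Set.mem_preimage, Set.mem_singleton_iff] at h1 h2
    simpa using (h1 x hx).symm.trans (h2 x hx)
  have hU : μ.real (⋃ x ∈ s, A x) = ∑ x ∈ s, μ.real (A x) :=
    measureReal_biUnion_finset hdisj fun x _ => hAm x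
  calc (1 / 8 : ℝ) ≤ (∑ i ∈ s, p i) * (1 / 2) := by linarith
    _ ≤ ∑ x ∈ s, μ.real (A x) := by rw [Finset.sum_mul]; exact Finset.sum_le_sum hAμ
    _ = μ.real (⋃ x ∈ s, A x) := hU.symm
    _ ≤ _ := measureReal_mono hsub

open MeasureTheory ProbabilityTheory in
lemma ProbabilityTheory.iIndepFun.measure_forall_card_ne_one_le {Ω ι κ : Type*}
    [MeasurableSpace Ω] [DecidableEq ι] {μ : Measure Ω} [IsProbabilityMeasure μ]
    {X : ι → Ω → Bool} (hX : iIndepFun X μ)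
    (hm : ∀ i, Measurable (X i)) {p : ι → ℝ} (hp : ∀ i, μ.real (X i ⁻¹' {true}) = p i)
    (J : Finset κ) (s : κ → Finset ι) (hs : Set.PairwiseDisjoint (↑J) s)
    (h₁ : ∀ j ∈ J, 1 / 4 ≤ ∑ i ∈ s j, p i) (h₂ : ∀ j ∈ J, ∑ i ∈ s j, p i ≤ 1 / 2) :
    μ.real {ω | ∀ j ∈ J, ((s j).filter fun i => X i ω = true).card ≠ 1} ≤ (7 / 8) ^ J.card := by
  classical
  induction J using Finset.induction_on with
  | empty => simp
  | insert a J ha ih =>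
    have ih' := ih (hs.subset (by simp)) (fun j hj => h₁ j (Finset.mem_insert_of_mem hj))
      (fun j hj => h₂ j (Finset.mem_insert_of_mem hj))
    have hd : Disjoint (s a) (J.biUnion s) := by
      refine (Finset.disjoint_biUnion_right _ _ _).2 fun j hj => hs (by simp) (by simp [hj]) ?_
      rintro rfl; exact ha hj
    have hI := hX.indepFun_finset (s a) (J.biUnion s) hd hm
    have key := hI.measure_inter_preimage_eq_mul
      {f | ((s a).filter fun i => ∃ h : i ∈ s a, f ⟨i, h⟩ = true).card ≠ 1}
      {f | ∀ j ∈ J, ((s j).filter fun i => ∃ h : i ∈ J.biUnion s, f ⟨i, h⟩ = true).card ≠ 1}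
      (Set.toFinite _).measurableSet (Set.toFinite _).measurableSet
    have e1 : (fun (ω : Ω) (i : s a) => X i ω) ⁻¹'
        {f | ((s a).filter fun i => ∃ h : i ∈ s a, f ⟨i, h⟩ = true).card ≠ 1}
        = {ω | ((s a).filter fun i => X i ω = true).card = 1}ᶜ := by
      ext ω
      simp only [Set.mem_preimage, Set.mem_compl_iff, Set.mem_ofPred_eq, exists_prop]
      rw [Finset.filter_congr (q := fun i => X i ω = true)]
      intro i hi; simp [hi]
    have e2 : (fun (ω : Ω) (i : J.biUnion s) => X i ω) ⁻¹'
        {f | ∀ j ∈ J, ((s j).filter fun i => ∃ h : i ∈ J.biUnion s, f ⟨i, h⟩ = true).card ≠ 1}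
        = {ω | ∀ j ∈ J, ((s j).filter fun i => X i ω = true).card ≠ 1} := by
      ext ω
      simp only [Set.mem_preimage, Set.mem_ofPred_eq, exists_prop]
      refine forall₂_congr fun j hj => ?_
      rw [Finset.filter_congr (q := fun i => X i ω = true)]
      intro i hi
      have : i ∈ J.biUnion s := Finset.mem_biUnion.2 ⟨j, hj, hi⟩
      simp only [this, true_and]
    rw [e1, e2] at key
    have hEm : MeasurableSet {ω | ((s a).filter fun i => X i ω = true).card = 1} := by
      have : MeasurableSet ((fun (ω : Ω) (i : s a) => X i ω) ⁻¹'
        {f | ((s a).filter fun i => ∃ h : i ∈ s a, f ⟨i, h⟩ = true).card ≠ 1}) :=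
        (measurable_pi_iff.2 fun i : s a => hm i)
          (Set.toFinite ({f | _} : Set (s a → Bool))).measurableSet
      rw [e1] at this
      simpa using this.compl
    have e3 : {ω | ∀ j ∈ insert a J, ((s j).filter fun i => X i ω = true).card ≠ 1}
        = {ω | ((s a).filter fun i => X i ω = true).card = 1}ᶜ ∩
          {ω | ∀ j ∈ J, ((s j).filter fun i => X i ω = true).card ≠ 1} := by
      ext ω; simp
    have h4 := hX.le_measure_card_eq_one hm hp (s a) (h₁ a (by simp)) (h₂ a (by simp))
    rw [e3, measureReal_def, key, ENNReal.toReal_mul, ← measureReal_def, ← measureReal_def,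
      probReal_compl_eq_one_sub hEm, Finset.card_insert_of_notMem ha, pow_succ, mul_comm]
    refine mul_le_mul ih' (by linarith) ?_ (by positivity)
    rw [sub_nonneg]; exact measureReal_le_one

open MeasureTheory ProbabilityTheory in
/-- The probabilistic method: each `c ∈ K` has pairwise disjoint sets `s c j`, `j ∈ J c`, of places.
If each of these has between `1 / 4` and `1 / 2` expected `1`s among independent bits, `c` fails to
have a set with exactly one `1` with probability at most `(7 / 8) ^ |J c|`, so if these numbers add
up to less than `1`, then some bits `U` fail for no `c`. -/
theorem exists_forall_exists_card_filter_eq_one {ι κ γ : Type*} [DecidableEq ι] (p : ι → ℝ)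
    (hp0 : ∀ i, 0 ≤ p i) (hp1 : ∀ i, p i ≤ 1) (K : Finset γ) (J : γ → Finset κ)
    (s : γ → κ → Finset ι) (hs : ∀ c ∈ K, Set.PairwiseDisjoint (↑(J c)) (s c))
    (h₁ : ∀ c ∈ K, ∀ j ∈ J c, 1 / 4 ≤ ∑ i ∈ s c j, p i)
    (h₂ : ∀ c ∈ K, ∀ j ∈ J c, ∑ i ∈ s c j, p i ≤ 1 / 2)
    (hsum : ∑ c ∈ K, (7 / 8 : ℝ) ^ (J c).card < 1) :
    ∃ U : ι → Bool, ∀ c ∈ K, ∃ j ∈ J c, ((s c j).filter fun i => U i = true).card = 1 := by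
  let ν : ι → Measure Bool := fun i => bernoulliMeasure true false ⟨p i, hp0 i, hp1 i⟩
  let μ : Measure (ι → Bool) := Measure.infinitePi ν
  let X : ι → (ι → Bool) → Bool := fun i ω => ω i
  have hX : iIndepFun X μ := iIndepFun_infinitePi (X := fun i (b : Bool) => b) (by fun_prop)
  have hm : ∀ i, Measurable (X i) := fun i => measurable_pi_apply i
  have hp : ∀ i, μ.real (X i ⁻¹' {true}) = p i := by
    intro i
    have h : μ.real (X i ⁻¹' {true}) = (ν i).real {true} :=
      (measurePreserving_eval_infinitePi ν i).measureReal_preimage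
        (MeasurableSet.nullMeasurableSet (measurableSet_singleton (α := Bool) true))
    rw [h]
    simp [ν]
  by_contra! hcon
  have hcov : (Set.univ : Set (ι → Bool)) ⊆
      ⋃ c ∈ K, {ω | ∀ j ∈ J c, ((s c j).filter fun i => X i ω = true).card ≠ 1} := by
    intro U _
    obtain ⟨c, hc, h⟩ := hcon U
    exact Set.mem_biUnion hc h
  have h1 : μ.real Set.univ ≤ ∑ c ∈ K, (7 / 8 : ℝ) ^ (J c).card :=
    calc μ.real Set.univ
        ≤ μ.real (⋃ c ∈ K, {ω | ∀ j ∈ J c, ((s c j).filter fun i => X i ω = true).card ≠ 1}) :=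
          measureReal_mono hcov (measure_ne_top _ _)
      _ ≤ ∑ c ∈ K, μ.real {ω | ∀ j ∈ J c, ((s c j).filter fun i => X i ω = true).card ≠ 1} :=
          measureReal_biUnion_finset_le _ _
      _ ≤ _ := Finset.sum_le_sum fun c hc =>
          hX.measure_forall_card_ne_one_le hm hp (J c) (s c) (hs c hc) (h₁ c hc) (h₂ c hc)
  simp at h1
  linarith

/-! ### Selective families -/

/-- The sequences `F v`, restricted to the first `m` places, form a selective family for sets of
at most `x` elements: each such nonempty set has a place in which exactly one of its elements has
a `1`. -/
def IsSelective (n : ℕ) (x : ℝ) (m : ℕ) (F : Fin n → ℕ → Bool) : Prop :=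
  ∀ X : Finset (Fin n), X.Nonempty → (X.card : ℝ) ≤ x →
    ∃ t < m, (X.filter fun v => F v t = true).card = 1

lemma seven_eighths_pow_le_exp (m : ℕ) : (7 / 8 : ℝ) ^ m ≤ Real.exp (-(m / 8)) := by
  have h : (7 / 8 : ℝ) ≤ Real.exp (-(1 / 8)) := by
    have := Real.add_one_le_exp (-(1 / 8) : ℝ)
    linarith
  calc (7 / 8 : ℝ) ^ m ≤ Real.exp (-(1 / 8)) ^ m := pow_le_pow_left₀ (by norm_num) h m
    _ = _ := by rw [← Real.exp_nat_mul]; ring_nf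

/-- The number of sets with at most `x` elements, by the generating function: with `t = x / n ≤ 1`
it is at most `t ^ (-x) ∑ t ^ |X| = t ^ (-x) (1 + t) ^ n`. -/
lemma card_filter_card_le_le_exp (n : ℕ) {x : ℝ} (hx : 0 < x) (hxn : x ≤ n) :
    ((Finset.univ.filter fun X : Finset (Fin n) => (X.card : ℝ) ≤ x).card : ℝ) ≤
      Real.exp (x * (1 + Real.log (n / x))) := by
  have hn : (0 : ℝ) < n := hx.trans_le hxn
  set t : ℝ := x / n with ht
  have ht0 : 0 < t := by positivity
  have ht1 : t ≤ 1 := (div_le_one hn).2 hxn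
  have h1 : ∑ X : Finset (Fin n), t ^ X.card = (t + 1) ^ n := by
    simpa using Fintype.sum_pow_mul_eq_add_pow (Fin n) t 1
  have h2 : ((Finset.univ.filter fun X : Finset (Fin n) => (X.card : ℝ) ≤ x).card : ℝ) * t ^ x
      ≤ ∑ X : Finset (Fin n), t ^ X.card := by
    rw [← nsmul_eq_mul]
    refine (Finset.card_nsmul_le_sum _ (fun X : Finset (Fin n) => t ^ X.card) _ ?_).trans
      (Finset.sum_le_sum_of_subset_of_nonneg (Finset.filter_subset _ _)
        fun _ _ _ => by positivity)
    intro X hX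
    rw [← Real.rpow_natCast]
    exact Real.rpow_le_rpow_of_exponent_ge ht0 ht1 (Finset.mem_filter.1 hX).2
  have h3 : (t + 1) ^ n ≤ Real.exp x := by
    calc (t + 1) ^ n ≤ Real.exp t ^ n :=
          pow_le_pow_left₀ (by positivity) (Real.add_one_le_exp t) n
      _ = Real.exp x := by rw [← Real.exp_nat_mul, ht]; congr 1; field_simp
  have h4 : t ^ x = Real.exp (-(x * Real.log (n / x))) := by
    rw [Real.rpow_def_of_pos ht0, ht, ← inv_div, Real.log_inv]; congr 1; ring
  rw [h4] at h2
  calc ((Finset.univ.filter fun X : Finset (Fin n) => (X.card : ℝ) ≤ x).card : ℝ)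
      = (((Finset.univ.filter fun X : Finset (Fin n) => (X.card : ℝ) ≤ x).card : ℝ)
        * Real.exp (-(x * Real.log (n / x)))) * Real.exp (x * Real.log (n / x)) := by
        rw [mul_assoc, ← Real.exp_add]; simp
    _ ≤ Real.exp x * Real.exp (x * Real.log (n / x)) := by
        gcongr; linarith
    _ = _ := by rw [← Real.exp_add]; ring_nf

/-- Sets of between `x / 2` and `x` elements are dealt with by independent random places, each of
which is a `1` with probability `1 / (2 x)`. -/
lemma exists_selective_of_half_lt (n : ℕ) {x : ℝ} (hx : 1 ≤ x) (hxn : x ≤ n) :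
    ∃ (m : ℕ) (F : Fin n → ℕ → Bool), (m : ℝ) ≤ 9 * (x * (1 + Real.log (n / x))) ∧
      ∀ X : Finset (Fin n), x / 2 < X.card → (X.card : ℝ) ≤ x →
        ∃ t < m, (X.filter fun v => F v t = true).card = 1 := by
  set y : ℝ := x * (1 + Real.log (n / x)) with hy
  have hlog : 0 ≤ Real.log (n / x) := Real.log_nonneg ((one_le_div (by linarith)).2 hxn)
  have hy1 : 1 ≤ y := by nlinarith
  have hm := Nat.floor_le (a := 8 * y) (by linarith)
  have hm' := Nat.lt_floor_add_one (8 * y)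
  set m : ℕ := ⌊8 * y⌋₊ + 1 with hmdef
  have hsum : ∀ (X : Finset (Fin n)) (t : ℕ),
      ∑ _i ∈ X ×ˢ {t}, 1 / (2 * x) = X.card / (2 * x) := by
    intro X t; simp [div_eq_mul_inv]
  obtain ⟨U, hU⟩ := exists_forall_exists_card_filter_eq_one
    (ι := Fin n × ℕ) (fun _ => 1 / (2 * x)) (fun _ => by positivity)
    (fun _ => by rw [div_le_one (by positivity)]; linarith)
    (Finset.univ.filter fun X : Finset (Fin n) => x / 2 < X.card ∧ (X.card : ℝ) ≤ x)
    (fun _ => Finset.range m) (fun X t => X ×ˢ {t})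
    (by
      intro X _ t _ t' _ h
      refine Finset.disjoint_left.2 fun i h1 h2 => h ?_
      simp only [Finset.mem_product, Finset.mem_singleton] at h1 h2
      exact h1.2.symm.trans h2.2)
    (by
      intro X hX t _
      have := (Finset.mem_filter.1 hX).2
      rw [hsum, le_div_iff₀ (by positivity)]; linarith)
    (by
      intro X hX t _
      have := (Finset.mem_filter.1 hX).2
      rw [hsum, div_le_iff₀ (by positivity)]; linarith)
    (by
      simp only [Finset.card_range, Finset.sum_const, nsmul_eq_mul]
      calc _ ≤ Real.exp y * Real.exp (-(m / 8)) := by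
            refine mul_le_mul ?_ (seven_eighths_pow_le_exp m) (by positivity) (by positivity)
            refine le_trans ?_ (card_filter_card_le_le_exp n (by linarith) hxn)
            exact_mod_cast Finset.card_le_card fun X hX => by
              simp only [Finset.mem_filter, Finset.mem_univ, true_and] at hX ⊢
              exact hX.2
        _ < 1 := by
            rw [← Real.exp_add, Real.exp_lt_one_iff]
            push_cast [hmdef]; linarith)
  refine ⟨m, fun v t => U (v, t), by push_cast [hmdef]; linarith, fun X h1 h2 => ?_⟩
  obtain ⟨t, ht, h⟩ := hU X (by simp [h1, h2])
  refine ⟨t, Finset.mem_range.1 ht, ?_⟩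
  rw [← h]
  refine Finset.card_bij (fun v _ => (v, t)) ?_ ?_ ?_
  · intro v hv; simpa using hv
  · intro v _ w _ hvw; exact (Prod.ext_iff.1 hvw).1
  · rintro ⟨v, t'⟩ h
    simp only [Finset.mem_filter, Finset.mem_product, Finset.mem_singleton] at h
    obtain ⟨⟨h1, rfl⟩, h2⟩ := h
    exact ⟨v, by simp [h1, h2], rfl⟩

/-- Selective families of size `O(x log (n / x))` exist: concatenate the families for sets of
`x / 2 ^ (i + 1)` to `x / 2 ^ i` elements, for which the bounds decrease geometrically, by the
factor `(1 + log 2) / 2 < 0.85`. -/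
theorem exists_isSelective (n : ℕ) {x : ℝ} (hx : 0 < x) (hxn : x ≤ n) :
    ∃ (m : ℕ) (F : Fin n → ℕ → Bool), (m : ℝ) ≤ 60 * (x * (1 + Real.log (n / x))) ∧
      IsSelective n x m F := by
  obtain ⟨N, hN⟩ := pow_unbounded_of_one_lt x (one_lt_two)
  induction N generalizing x with
  | zero =>
    have hlog : 0 ≤ Real.log (n / x) := Real.log_nonneg ((one_le_div (by linarith)).2 hxn)
    refine ⟨0, fun _ _ => false, by push_cast; positivity, fun X hX h => ?_⟩
    have : (1 : ℝ) ≤ X.card := by exact_mod_cast hX.card_pos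
    linarith
  | succ N ih =>
    have hlog : 0 ≤ Real.log (n / x) := Real.log_nonneg ((one_le_div (by linarith)).2 hxn)
    rcases lt_or_ge x 1 with h1 | h1
    · refine ⟨0, fun _ _ => false, by push_cast; positivity, fun X hX h => ?_⟩
      have : (1 : ℝ) ≤ X.card := by exact_mod_cast hX.card_pos
      linarith
    obtain ⟨m₁, F₁, hm₁, hF₁⟩ := ih (x := x / 2) (by linarith) (by linarith)
      (by rw [pow_succ] at hN; linarith)
    obtain ⟨m₂, F₂, hm₂, hF₂⟩ := exists_selective_of_half_lt n h1 hxn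
    refine ⟨m₁ + m₂, fun v t => if t < m₁ then F₁ v t else F₂ v (t - m₁), ?_, fun X hX hc => ?_⟩
    · have e : Real.log (n / (x / 2)) = Real.log (n / x) + Real.log 2 := by
        have hn : (0 : ℝ) < n := by linarith
        rw [← Real.log_mul (by positivity) (by norm_num)]; congr 1; field_simp
      rw [e] at hm₁
      have h2 : Real.log 2 < 0.7 := Real.log_two_lt_d9.trans (by norm_num)
      push_cast
      nlinarith [mul_nonneg hx.le hlog, mul_lt_mul_of_pos_left h2 hx]
    · rcases le_or_gt (X.card : ℝ) (x / 2) with h | h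
      · obtain ⟨t, ht, h⟩ := hF₁ X hX h
        exact ⟨t, by omega, by simpa [ht] using h⟩
      · obtain ⟨t, ht, h⟩ := hF₂ X h hc
        exact ⟨m₁ + t, by omega, by simpa using h⟩

/-! ### Schedules and block loads -/

/-- A schedule assigns to each of `n` elements a number in `{0, …, i + 1}`; the bound counts the
schedules in which at most `y` elements have values in `{0, …, i}`, by a generating function. -/
lemma card_schedules_le_exp (n i : ℕ) {d y : ℝ} (hd : 1 ≤ d) (hy : y = n / d * (i + 1)) :
    (((Fintype.piFinset fun _ : Fin n => Finset.range (i + 2)).filter fun a =>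
      ((Finset.univ.filter fun v => a v ≤ i).card : ℝ) ≤ y).card : ℝ) ≤
      Real.exp (y * (1 + Real.log d)) := by
  set P := Fintype.piFinset fun _ : Fin n => Finset.range (i + 2)
  set t : ℝ := 1 / d with ht
  have ht0 : 0 < t := by positivity
  have ht1 : t ≤ 1 := (div_le_one (by linarith)).2 hd
  have hw : ∀ a : Fin n → ℕ,
      ∏ v, (if a v ≤ i then t else 1) = t ^ (Finset.univ.filter fun v => a v ≤ i).card := by
    intro a; simp [Finset.prod_ite]
  have h1 : ∑ a ∈ P, ∏ v, (if a v ≤ i then t else 1) = ((i + 1) * t + 1) ^ n := by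
    have h := Finset.prod_univ_sum (fun _ : Fin n => Finset.range (i + 2))
      (fun _ x => if x ≤ i then t else 1)
    rw [← h]
    have : ∑ x ∈ Finset.range (i + 2), (if x ≤ i then t else 1) = (i + 1) * t + 1 := by
      rw [Finset.sum_range_succ, Finset.sum_congr rfl (g := fun _ => t)]
      · simp
      · intro x hx
        rw [if_pos (by have := Finset.mem_range.1 hx; omega)]
    simp [this]
  have h2 : ((P.filter fun a =>
      ((Finset.univ.filter fun v => a v ≤ i).card : ℝ) ≤ y).card : ℝ) * t ^ y
      ≤ ∑ a ∈ P, ∏ v, (if a v ≤ i then t else 1) := by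
    rw [← nsmul_eq_mul]
    refine (Finset.card_nsmul_le_sum _ (fun a : Fin n → ℕ => ∏ v, (if a v ≤ i then t else 1))
      _ ?_).trans (Finset.sum_le_sum_of_subset_of_nonneg (Finset.filter_subset _ _)
        fun a _ _ => by rw [hw]; positivity)
    intro a ha
    rw [hw, ← Real.rpow_natCast]
    exact Real.rpow_le_rpow_of_exponent_ge ht0 ht1 (Finset.mem_filter.1 ha).2
  have h3 : ((i + 1) * t + 1) ^ n ≤ Real.exp y := by
    calc ((i + 1) * t + 1) ^ n ≤ Real.exp ((i + 1) * t) ^ n :=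
          pow_le_pow_left₀ (by positivity) (Real.add_one_le_exp _) n
      _ = Real.exp y := by rw [← Real.exp_nat_mul, ht, hy]; congr 1; ring
  have h4 : t ^ y = Real.exp (-(y * Real.log d)) := by
    rw [Real.rpow_def_of_pos ht0, ht, one_div, Real.log_inv]; congr 1; ring
  rw [h4] at h2
  set c : ℝ := ((P.filter fun a =>
      ((Finset.univ.filter fun v => a v ≤ i).card : ℝ) ≤ y).card : ℝ)
  calc c = (c * Real.exp (-(y * Real.log d))) * Real.exp (y * Real.log d) := by
        rw [mul_assoc, ← Real.exp_add]; simp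
    _ ≤ Real.exp y * Real.exp (y * Real.log d) := by
        gcongr; linarith
    _ = _ := by rw [← Real.exp_add]; ring_nf

/-- The load of block `j` under the schedule `a`: an element that starts in block `b` contributes
`1 / (r (j - b + 1))` to every block `j ≥ b`. -/
noncomputable def blockLoad {n : ℕ} (r : ℝ) (a : Fin n → ℕ) (j : ℕ) : ℝ :=
  ∑ v ∈ Finset.univ.filter (fun v => a v ≤ j), 1 / (r * ((j - a v : ℕ) + 1))

lemma one_le_blockLoad {n : ℕ} {r : ℝ} (hr : 0 < r) (a : Fin n → ℕ) (j : ℕ)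
    (h : r * (j + 1) ≤ (Finset.univ.filter fun v => a v ≤ j).card) :
    1 ≤ blockLoad r a j := by
  have h1 : ∀ v ∈ Finset.univ.filter (fun v => a v ≤ j),
      1 / (r * (j + 1)) ≤ 1 / (r * ((j - a v : ℕ) + 1)) := by
    intro v _
    have : ((j - a v : ℕ) : ℝ) ≤ j := by exact_mod_cast Nat.sub_le _ _
    gcongr
  have h2 := Finset.card_nsmul_le_sum _ _ _ h1
  refine le_trans ?_ h2
  rw [nsmul_eq_mul, mul_one_div, le_div_iff₀ (by positivity)]
  linarith

lemma sum_blockLoad_le {n : ℕ} {r : ℝ} (hr : 0 < r) (a : Fin n → ℕ) (i : ℕ)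
    (h : ((Finset.univ.filter fun v => a v ≤ i).card : ℝ) ≤ r * (i + 1)) :
    ∑ j ∈ Finset.range i, blockLoad r a j ≤ (i + 1) * (1 + Real.log i) := by
  have hH : ∀ v, ∑ j ∈ Finset.range i, (if a v ≤ j then 1 / (r * ((j - a v : ℕ) + 1)) else 0) ≤
      if a v ≤ i then (1 + Real.log i) / r else 0 := by
    intro v
    rw [← Finset.sum_filter]
    split_ifs with hv
    · have e : (Finset.range i).filter (fun j => a v ≤ j) = Finset.Ico (a v) i := by
        ext j; simp [and_comm]
      rw [e, Finset.sum_Ico_eq_sum_range]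
      have h1 : ∑ k ∈ Finset.range (i - a v), 1 / (r * ((a v + k - a v : ℕ) + 1))
          ≤ ∑ k ∈ Finset.range i, 1 / r * ((k : ℝ) + 1)⁻¹ := by
        simp only [Nat.add_sub_cancel_left, one_div, mul_inv]
        exact Finset.sum_le_sum_of_subset_of_nonneg
          (Finset.range_mono (Nat.sub_le _ _)) fun _ _ _ => by positivity
      refine h1.trans ?_
      rw [← Finset.mul_sum, one_div, div_eq_inv_mul]
      have h2 := harmonic_le_one_add_log i
      simp only [harmonic] at h2
      push_cast at h2
      gcongr
    · refine (Finset.sum_eq_zero fun j hj => ?_).le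
      simp only [Finset.mem_filter, Finset.mem_range] at hj
      omega
  have hlog : 0 ≤ Real.log i := Real.log_natCast_nonneg i
  calc ∑ j ∈ Finset.range i, blockLoad r a j
      = ∑ v, ∑ j ∈ Finset.range i, (if a v ≤ j then 1 / (r * ((j - a v : ℕ) + 1)) else 0) := by
        simp only [blockLoad, Finset.sum_filter]; exact Finset.sum_comm
    _ ≤ ∑ v, if a v ≤ i then (1 + Real.log i) / r else 0 := Finset.sum_le_sum fun v _ => hH v
    _ = (Finset.univ.filter fun v => a v ≤ i).card * ((1 + Real.log i) / r) := by
        rw [← Finset.sum_filter, Finset.sum_const, nsmul_eq_mul]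
    _ ≤ (r * (i + 1)) * ((1 + Real.log i) / r) := by gcongr
    _ = _ := by field_simp

/-- At least half of the blocks have a load of at most twice the bound on the average. -/
lemma half_le_card_blockLoad_le {n : ℕ} {r : ℝ} (hr : 0 < r) (a : Fin n → ℕ) {i : ℕ} (hi : 1 ≤ i)
    (h : ((Finset.univ.filter fun v => a v ≤ i).card : ℝ) ≤ r * (i + 1)) :
    (i : ℝ) / 2 ≤
      ((Finset.range i).filter fun j => blockLoad r a j ≤ 4 * (1 + Real.log i)).card := by
  have hs := sum_blockLoad_le hr a i h
  set M := 4 * (1 + Real.log i) with hM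
  have hlog : 0 ≤ Real.log i := Real.log_natCast_nonneg i
  have hM0 : 0 < M := by positivity
  have h1 := Finset.card_filter_add_card_filter_not (s := Finset.range i)
    (fun j => blockLoad r a j ≤ M)
  rw [Finset.card_range] at h1
  have h2 : (((Finset.range i).filter fun j => ¬ blockLoad r a j ≤ M).card : ℝ) * M
      ≤ ∑ j ∈ Finset.range i, blockLoad r a j := by
    rw [← nsmul_eq_mul]
    refine (Finset.card_nsmul_le_sum _ (blockLoad r a) _ fun j hj =>
      (not_le.1 (Finset.mem_filter.1 hj).2).le).trans
      (Finset.sum_le_sum_of_subset_of_nonneg (Finset.filter_subset _ _) fun j _ _ => ?_)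
    exact Finset.sum_nonneg fun v _ => by positivity
  have h3 : (((Finset.range i).filter fun j => ¬ blockLoad r a j ≤ M).card : ℝ) ≤ i / 2 := by
    have hi' : (1 : ℝ) ≤ i := by exact_mod_cast hi
    refine le_of_mul_le_mul_right (h2.trans (hs.trans ?_)) hM0
    rw [hM]; nlinarith
  have h4 : (((Finset.range i).filter fun j => blockLoad r a j ≤ M).card : ℝ)
      + ((Finset.range i).filter fun j => ¬ blockLoad r a j ≤ M).card = i := by exact_mod_cast h1
  linarith

/-- The dyadic scale that brings `L ≥ 1` down to the interval `[1 / 4, 1 / 2]`. -/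
lemma exists_dyadic_scale (L : ℝ) (hL : 1 ≤ L) :
    ∃ q : ℕ, 1 ≤ q ∧ 1 / 4 ≤ L / 2 ^ q ∧ L / 2 ^ q ≤ 1 / 2 ∧ ∀ Q : ℕ, 2 * L ≤ 2 ^ Q → q ≤ Q := by
  classical
  have hex : ∃ q : ℕ, 2 * L ≤ 2 ^ q :=
    (pow_unbounded_of_one_lt (2 * L) one_lt_two).imp fun _ h => h.le
  have h1 : 1 ≤ Nat.find hex := by
    rw [Nat.one_le_iff_ne_zero]; intro h0
    have := Nat.find_spec hex
    rw [h0] at this; norm_num at this; linarith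
  refine ⟨Nat.find hex, h1, ?_, ?_, fun Q hQ => Nat.find_min' hex hQ⟩
  · have h2 := Nat.find_min hex (m := Nat.find hex - 1) (by omega)
    obtain ⟨k, hk⟩ : ∃ k, Nat.find hex = k + 1 := ⟨Nat.find hex - 1, by omega⟩
    rw [hk, Nat.add_sub_cancel] at h2
    rw [hk, le_div_iff₀ (by positivity), pow_succ]; linarith
  · have := Nat.find_spec hex
    rw [div_le_iff₀ (by positivity)]; linarith

/-- A random bit for a place at position `t ≥ m` of a block in which its owner has age `k` is a `1`
with probability `2 ^ (-q) / (r (k + 1))`, where the scale `q` runs through `1, …, Q` as `t` grows,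
with `N` repetitions of each scale.  So the expected number of `1`s in a column of scale `q` is the
load of the block over `2 ^ q`.  A schedule with at least `r (j + 1)` started elements in each
block `j < i` and at most `r (i + 1)` in block `i` has at least `i / 2` blocks with loads between
`1` and `4 (1 + log i)`, each with a scale whose `N` columns succeed with constant probability.
This beats the number `exp (r (i + 1) (1 + log D))` of these schedules. -/
lemma exists_hits_heavy_schedules {n D m N Q B : ℕ} {x : ℝ} (hD : 1 ≤ D) (hDn : D ≤ n)
    (hB : m + Q * N ≤ B)
    (hN : 48 * ((n : ℝ) / D * (1 + Real.log D)) ≤ N)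
    (hQ : ∀ i : ℕ, 1 ≤ i → (i : ℝ) ≤ x → 8 * (1 + Real.log i) ≤ 2 ^ Q) :
    ∃ U : Fin n × ℕ → Bool, ∀ (i : ℕ) (a : Fin n → ℕ), 1 ≤ i → i < D → (i : ℝ) ≤ x →
      (∀ v, a v ≤ i + 1) →
      ((Finset.univ.filter fun v => a v ≤ i).card : ℝ) ≤ (n : ℝ) / D * (i + 1) →
      (∀ j < i, (n : ℝ) / D * (j + 1) ≤ (Finset.univ.filter fun v => a v ≤ j).card) →
      ∃ j < i, ∃ t, m ≤ t ∧ t < B ∧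
        (Finset.univ.filter fun v => a v ≤ j ∧ U (v, (j - a v) * B + t) = true).card = 1 := by
  classical
  have hD0 : (1 : ℝ) ≤ D := by exact_mod_cast hD
  set r : ℝ := (n : ℝ) / D with hr
  have hr1 : 1 ≤ r := (one_le_div (by linarith)).2 (by exact_mod_cast hDn)
  have hlogD : 0 ≤ Real.log D := Real.log_nonneg hD0
  have hN0 : 0 < N := by
    have : (0 : ℝ) < N := lt_of_lt_of_le (by positivity) hN
    exact_mod_cast this
  choose! sc hsc1 hsc2 hsc3 hscQ using exists_dyadic_scale
  -- the position in a block that belongs to repetition `u` of scale `q`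
  let pos : ℕ → ℕ → ℕ := fun q u => m + (q - 1) * N + u
  let p : Fin n × ℕ → ℝ := fun i =>
    1 / (2 ^ ((i.2 % B - m) / N + 1) * (r * ((i.2 / B : ℕ) + 1)))
  have hp0 : ∀ i, 0 ≤ p i := fun i => by positivity
  have hp1 : ∀ i, p i ≤ 1 := fun i => by
    refine (div_le_one (by positivity)).2 (one_le_mul_of_one_le_of_one_le ?_ ?_)
    · exact one_le_pow₀ (by norm_num)
    · exact one_le_mul_of_one_le_of_one_le hr1 (by simp)
  let K : Finset (Σ _ : ℕ, (Fin n → ℕ)) :=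
    ((Finset.Ico 1 D).filter fun i : ℕ => (i : ℝ) ≤ x).sigma fun i : ℕ =>
      ((Fintype.piFinset fun _ : Fin n => Finset.range (i + 2)).filter fun a =>
        ((Finset.univ.filter fun v => a v ≤ i).card : ℝ) ≤ r * (i + 1)).filter fun a =>
          ∀ j < i, r * (j + 1) ≤ (Finset.univ.filter fun v => a v ≤ j).card
  -- the blocks of moderate load, the chosen columns and the places in a column
  let G : (Σ _ : ℕ, (Fin n → ℕ)) → Finset ℕ := fun c =>
    (Finset.range c.1).filter fun j => blockLoad r c.2 j ≤ 4 * (1 + Real.log c.1)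
  let J : (Σ _ : ℕ, (Fin n → ℕ)) → Finset (ℕ × ℕ) := fun c => G c ×ˢ Finset.range N
  let col : (Σ _ : ℕ, (Fin n → ℕ)) → ℕ × ℕ → Finset (Fin n × ℕ) := fun c k =>
    (Finset.univ.filter fun v => c.2 v ≤ k.1).image fun v =>
      (v, (k.1 - c.2 v) * B + pos (sc (blockLoad r c.2 k.1)) k.2)
  have hK : ∀ c ∈ K, 1 ≤ c.1 ∧ c.1 < D ∧ (c.1 : ℝ) ≤ x ∧
      ((Finset.univ.filter fun v => c.2 v ≤ c.1).card : ℝ) ≤ r * (c.1 + 1) ∧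
      ∀ j < c.1, r * (j + 1) ≤ (Finset.univ.filter fun v => c.2 v ≤ j).card := by
    intro c hc
    simp only [K, Finset.mem_sigma, Finset.mem_filter, Finset.mem_Ico] at hc
    exact ⟨hc.1.1.1, hc.1.1.2, hc.1.2, hc.2.1.2, hc.2.2⟩
  have hscale : ∀ c ∈ K, ∀ j ∈ G c, 1 ≤ blockLoad r c.2 j ∧ sc (blockLoad r c.2 j) ≤ Q := by
    intro c hc j hj
    obtain ⟨h1, -, hx, h2, h3⟩ := hK c hc
    simp only [G, Finset.mem_filter, Finset.mem_range] at hj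
    have h4 := one_le_blockLoad (by linarith) c.2 j (h3 j hj.1)
    exact ⟨h4, hscQ _ h4 _ (by linarith [hQ c.1 h1 hx])⟩
  have hposB : ∀ q u, 1 ≤ q → q ≤ Q → u < N → pos q u < B := by
    intro q u h1 h2 h3
    obtain ⟨q', rfl⟩ : ∃ q', q = q' + 1 := ⟨q - 1, by omega⟩
    have : (q' + 1) * N ≤ Q * N := Nat.mul_le_mul_right N h2
    simp only [pos, Nat.add_sub_cancel]
    rw [add_one_mul] at this
    omega
  have hload : ∀ c ∈ K, ∀ k ∈ J c, ∑ i ∈ col c k, p i =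
      blockLoad r c.2 k.1 / 2 ^ sc (blockLoad r c.2 k.1) := by
    intro c hc k hk
    obtain ⟨hkG, hkN⟩ := Finset.mem_product.1 hk
    obtain ⟨hL, hq⟩ := hscale c hc k.1 hkG
    have hq1 := hsc1 _ hL
    set q := sc (blockLoad r c.2 k.1) with hqdef
    have hlt := hposB q k.2 hq1 hq (Finset.mem_range.1 hkN)
    simp only [col]
    rw [Finset.sum_image (fun v _ w _ h => (Prod.ext_iff.1 h).1)]
    conv_rhs => rw [blockLoad, Finset.sum_div]
    refine Finset.sum_congr rfl fun v _ => ?_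
    simp only [p, ← hqdef]
    have e1 : ((k.1 - c.2 v) * B + pos q k.2) % B = pos q k.2 := by
      rw [Nat.mul_add_mod', Nat.mod_eq_of_lt hlt]
    have e2 : ((k.1 - c.2 v) * B + pos q k.2) / B = k.1 - c.2 v := by
      rw [mul_comm, Nat.mul_add_div (by omega), Nat.div_eq_of_lt hlt, add_zero]
    have e3 : (pos q k.2 - m) / N + 1 = q := by
      have : pos q k.2 - m = N * (q - 1) + k.2 := by simp only [pos]; rw [mul_comm N]; omega
      rw [this, Nat.mul_add_div hN0, Nat.div_eq_of_lt (Finset.mem_range.1 hkN)]; omega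
    rw [e1, e2, e3]
    field_simp
  have hJ : ∀ c ∈ K, (c.1 : ℝ) / 2 * N ≤ (J c).card := by
    intro c hc
    obtain ⟨h1, -, hx, h2, h3⟩ := hK c hc
    rw [Finset.card_product, Finset.card_range]
    push_cast
    exact mul_le_mul_of_nonneg_right (half_le_card_blockLoad_le (by linarith) c.2 h1 h2)
      (by positivity)
  -- by `card_schedules_le_exp` every `i` contributes at most `exp (-(1 + log D)) = 1 / (e D)` to
  -- the failure probability
  have hfail : ∑ c ∈ K, (7 / 8 : ℝ) ^ (J c).card < 1 := by
    have h1 : ∀ c ∈ K,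
        (7 / 8 : ℝ) ^ (J c).card ≤ Real.exp (-(3 * (c.1 * (r * (1 + Real.log D))))) := by
      intro c hc
      refine (seven_eighths_pow_le_exp _).trans (Real.exp_le_exp.2 ?_)
      have := hJ c hc
      have h2 : (c.1 : ℝ) * (48 * (r * (1 + Real.log D))) ≤ c.1 * N := by gcongr
      linarith
    refine (Finset.sum_le_sum h1).trans_lt ?_
    rw [Finset.sum_sigma]
    have h2 : ∀ i ∈ (Finset.Ico 1 D).filter (fun i : ℕ => (i : ℝ) ≤ x),
        ∑ a ∈ ((Fintype.piFinset fun _ : Fin n => Finset.range (i + 2)).filter fun a =>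
          ((Finset.univ.filter fun v => a v ≤ i).card : ℝ) ≤ r * (i + 1)).filter (fun a =>
          ∀ j < i, r * (j + 1) ≤ (Finset.univ.filter fun v => a v ≤ j).card),
          Real.exp (-(3 * (i * (r * (1 + Real.log D))))) ≤ Real.exp (-1) / D := by
      intro i hi
      have hi1 : (1 : ℝ) ≤ i := by
        have := (Finset.mem_Ico.1 (Finset.mem_filter.1 hi).1).1
        exact_mod_cast this
      rw [Finset.sum_const, nsmul_eq_mul]
      have h3 := card_schedules_le_exp n i hD0 (y := r * (i + 1)) rfl
      have h4 : Real.exp (-1) / D = Real.exp (-(1 + Real.log D)) := by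
        rw [neg_add, Real.exp_add, Real.exp_neg (Real.log D), Real.exp_log (by linarith)]; rfl
      rw [h4]
      calc _ ≤ Real.exp (r * (i + 1) * (1 + Real.log D)) *
            Real.exp (-(3 * (i * (r * (1 + Real.log D))))) := by
            refine mul_le_mul_of_nonneg_right (le_trans ?_ h3) (by positivity)
            exact_mod_cast Finset.card_le_card (Finset.filter_subset _ _)
        _ ≤ _ := by
            rw [← Real.exp_add]
            refine Real.exp_le_exp.2 ?_
            have h5 : 1 * (1 + Real.log D) ≤ r * (1 + Real.log D) := by gcongr
            nlinarith
    refine (Finset.sum_le_sum h2).trans_lt ?_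
    rw [Finset.sum_const, nsmul_eq_mul]
    have h3 : (((Finset.Ico 1 D).filter fun i : ℕ => (i : ℝ) ≤ x).card : ℝ) ≤ D := by
      have := (Finset.card_filter_le (Finset.Ico 1 D) fun i : ℕ => (i : ℝ) ≤ x)
      rw [Nat.card_Ico] at this
      exact_mod_cast this.trans (Nat.sub_le _ _)
    calc _ ≤ (D : ℝ) * (Real.exp (-1) / D) := by gcongr
      _ = Real.exp (-1) := by field_simp
      _ < 1 := by simp
  obtain ⟨U, hU⟩ := exists_forall_exists_card_filter_eq_one p hp0 hp1 K J col
    (by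
      intro c hc k hk k' hk' hne
      refine Finset.disjoint_left.2 fun i h1 h2 => hne ?_
      simp only [col, Finset.mem_image, Finset.mem_filter, Finset.mem_univ, true_and] at h1 h2
      obtain ⟨v, hv, rfl⟩ := h1
      obtain ⟨w, hw, h⟩ := h2
      obtain ⟨hwv, h⟩ := Prod.ext_iff.1 h
      simp only at hwv
      subst hwv
      obtain ⟨hkG, hkN⟩ := Finset.mem_product.1 hk
      obtain ⟨hkG', hkN'⟩ := Finset.mem_product.1 hk'
      obtain ⟨hL, hq⟩ := hscale c hc _ hkG
      obtain ⟨hL', hq'⟩ := hscale c hc _ hkG'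
      have hlt := hposB _ k.2 (hsc1 _ hL) hq (Finset.mem_range.1 hkN)
      have hlt' := hposB _ k'.2 (hsc1 _ hL') hq' (Finset.mem_range.1 hkN')
      simp only at h
      have hB0 : 0 < B := by omega
      have e1 := congrArg (· / B) h
      simp only [mul_comm _ B, Nat.mul_add_div hB0, Nat.div_eq_of_lt hlt,
        Nat.div_eq_of_lt hlt', add_zero] at e1
      have e2 : k'.1 = k.1 := by omega
      rw [e2] at h
      refine Prod.ext e2.symm ?_
      simp only [pos] at h
      omega)
    (fun c hc k hk => by
      rw [hload c hc k hk]
      exact hsc2 _ (hscale c hc k.1 (Finset.mem_product.1 hk).1).1)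
    (fun c hc k hk => by
      rw [hload c hc k hk]
      exact hsc3 _ (hscale c hc k.1 (Finset.mem_product.1 hk).1).1)
    hfail
  refine ⟨U, fun i a h1 h2 h3 h4 h5 h6 => ?_⟩
  have hc : (⟨i, a⟩ : Σ _ : ℕ, (Fin n → ℕ)) ∈ K := by
    simp only [K, Finset.mem_sigma, Finset.mem_filter, Finset.mem_Ico, Fintype.mem_piFinset,
      Finset.mem_range]
    exact ⟨⟨⟨h1, h2⟩, h3⟩, ⟨fun v => by have := h4 v; omega, h5⟩, h6⟩
  obtain ⟨k, hk, hcard⟩ := hU _ hc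
  obtain ⟨hkG, hkN⟩ := Finset.mem_product.1 hk
  obtain ⟨hL, hq⟩ := hscale _ hc k.1 hkG
  refine ⟨k.1, Finset.mem_range.1 (Finset.mem_filter.1 hkG).1,
    pos (sc (blockLoad r a k.1)) k.2, by simp only [pos]; omega,
    hposB _ _ (hsc1 _ hL) hq (Finset.mem_range.1 hkN), ?_⟩
  rw [← hcard]
  simp only [col]
  rw [Finset.filter_image, Finset.card_image_of_injective _ fun v w h => (Prod.ext_iff.1 h).1,
    Finset.filter_filter]

/-! ### From schedules to block synchronizers -/

namespace Radio

/-- Let `i` be the first block (counted from the first start) in which at most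
`r (i + 1)` elements of `X` have started.  It lies in the window of `X`.  If `i = 0`, the selective
family in the first places of the block isolates an element; otherwise every block `j < i` has more
than `r (j + 1)` started elements, and the random places isolate one of them. -/
theorem exists_isBlockSynchronizer {n D Δ m N Q B : ℕ} {F : Fin n → ℕ → Bool}
    (hD : 1 ≤ D) (hDn : D ≤ n) (hF : IsSelective n ((n : ℝ) / D) m F)
    (hB0 : 0 < B) (hB : m + Q * N ≤ B)
    (hN : 48 * ((n : ℝ) / D * (1 + Real.log D)) ≤ N)
    (hQ : ∀ i : ℕ, 1 ≤ i → (i : ℝ) ≤ Δ / ((n : ℝ) / D) → 8 * (1 + Real.log i) ≤ 2 ^ Q) :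
    ∃ S : Fin n → ℕ → Bool, IsBlockSynchronizer n Δ ((n : ℝ) / D) B S := by
  classical
  obtain ⟨U, hU⟩ := exists_hits_heavy_schedules hD hDn hB hN hQ
  have hD0 : (1 : ℝ) ≤ D := by exact_mod_cast hD
  have hn0 : (1 : ℝ) ≤ n := by exact_mod_cast hD.trans hDn
  set r : ℝ := (n : ℝ) / D with hr
  have hr0 : 0 < r := by positivity
  -- the first `m` places of the first block hold the selective family, the others random bits
  refine ⟨fun v k => if k % B < m then decide (k / B = 0) && F v k else U (v, k),
    fun ω X hX hXΔ => ?_⟩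
  -- `s v` is the block in which `v` starts, `s₀` the first of these blocks
  set s : Fin n → ℕ := fun v => ω v ⌈/⌉ B with hs
  set s₀ : ℕ := X.inf' hX ω ⌈/⌉ B with hs₀
  have hs₀le : ∀ v ∈ X, s₀ ≤ s v := fun v hv =>
    (gc_mul_ceilDiv hB0).monotone_l (Finset.inf'_le ω hv)
  obtain ⟨v₀, hv₀X, hv₀⟩ : ∃ v ∈ X, s v = s₀ := by
    obtain ⟨v, hv, h⟩ := Finset.exists_mem_eq_inf' hX ω
    exact ⟨v, hv, by simp only [hs, hs₀, h]⟩
  -- the elements that have started by block `i`, counted from the first start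
  let cnt : ℕ → Finset (Fin n) := fun i => X.filter fun v => s v ≤ s₀ + i
  set W : ℕ := ⌈(X.card : ℝ) / r⌉₊ with hW
  have hW1 : 1 ≤ W := Nat.one_le_ceil_iff.2 (by have := hX.card_pos; positivity)
  have hWD : W ≤ D := by
    refine Nat.ceil_le.2 ?_
    rw [div_le_iff₀ hr0, hr, mul_div_cancel₀ _ (by positivity)]
    exact_mod_cast (Finset.card_le_univ X).trans (by simp)
  have hcnt : ∃ i : ℕ, ((cnt i).card : ℝ) ≤ r * (i + 1) := by
    refine ⟨W - 1, ?_⟩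
    have h1 : ((cnt (W - 1)).card : ℝ) ≤ X.card := by
      exact_mod_cast Finset.card_filter_le _ _
    have h2 := Nat.le_ceil ((X.card : ℝ) / r)
    rw [div_le_iff₀ hr0] at h2
    push_cast [Nat.cast_sub hW1]
    rw [sub_add_cancel]
    linarith
  have hmin : ∀ j < Nat.find hcnt, r * (j + 1) ≤ (cnt j).card := fun j hj =>
    (not_le.1 (Nat.find_min hcnt hj)).le
  have hspec := Nat.find_spec hcnt
  have hiW : Nat.find hcnt < W := by
    rw [hW, Nat.lt_ceil, lt_div_iff₀ hr0]
    rcases Nat.eq_zero_or_pos (Nat.find hcnt) with h0 | h0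
    · rw [h0]; simpa using hX.card_pos
    · have h1 := not_le.1 (Nat.find_min hcnt (Nat.sub_lt h0 one_pos))
      push_cast [Nat.cast_sub (Nat.one_le_iff_ne_zero.2 h0.ne')] at h1
      rw [sub_add_cancel] at h1
      have h2 : ((cnt (Nat.find hcnt - 1)).card : ℝ) ≤ X.card := by
        exact_mod_cast Finset.card_filter_le _ _
      linarith
  set i : ℕ := Nat.find hcnt with hi
  have hcol : ∀ j t, t < B → ∀ v, s v * B ≤ (s₀ + j) * B + t ↔ s v ≤ s₀ + j := by
    intro j t ht v
    constructor
    · intro h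
      have h1 : s v * B < (s₀ + j + 1) * B := by rw [add_one_mul]; omega
      have := Nat.lt_of_mul_lt_mul_right h1
      omega
    · intro h
      exact (Nat.mul_le_mul_right B h).trans (Nat.le_add_right _ _)
  rcases Nat.eq_zero_or_pos i with h0 | h0
  · -- at most `r` elements start in the first block
    rw [h0] at hspec
    obtain ⟨t, ht, hcard⟩ := hF (cnt 0) ⟨v₀, by simp [cnt, hv₀X, hv₀]⟩ (by simpa using hspec)
    have htB : t < B := by omega
    refine ⟨s₀ * B + t, Nat.le_add_right _ _, ?_, ?_⟩
    · change s₀ * B + t < s₀ * B + B * W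
      have : B * 1 ≤ B * W := Nat.mul_le_mul_left B hW1
      omega
    · rw [← hcard, Finset.filter_filter]
      refine congrArg Finset.card (Finset.filter_congr fun v hv => ?_)
      change (s v * B ≤ s₀ * B + t ∧ _ ) ↔ _
      have h1 := hcol 0 t htB v
      rw [add_zero] at h1
      rw [h1, add_zero]
      refine and_congr_right fun h2 => ?_
      have h3 : s v = s₀ := le_antisymm h2 (hs₀le v hv)
      have h4 : s₀ * B + t - blockStart B (ω v) = t := by
        change s₀ * B + t - s v * B = t
        rw [h3]; omega
      rw [h4]
      simp [Nat.mod_eq_of_lt htB, ht, Nat.div_eq_of_lt htB]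
  · -- the schedule of the elements that start by block `i`; the value `i + 1` stands for all others
    let a : Fin n → ℕ := fun v => if v ∈ X ∧ s v ≤ s₀ + i then s v - s₀ else i + 1
    have ha : ∀ j ≤ i, ∀ v, a v ≤ j ↔ v ∈ X ∧ s v ≤ s₀ + j := by
      intro j hj v
      by_cases h : v ∈ X ∧ s v ≤ s₀ + i
      · simp only [a, if_pos h, h.1, true_and]; have := hs₀le v h.1; omega
      · simp only [a, if_neg h]
        constructor
        · intro h'; omega
        · rintro ⟨h1, h2⟩; exact absurd ⟨h1, by omega⟩ h
    have hacnt : ∀ j ≤ i, (Finset.univ.filter fun v => a v ≤ j) = cnt j := by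
      intro j hj; ext v; simp [cnt, ha j hj v]
    have hix : (i : ℝ) ≤ Δ / r := by
      rw [le_div_iff₀ hr0]
      have h1 := hmin (i - 1) (by omega)
      push_cast [Nat.cast_sub (Nat.one_le_iff_ne_zero.2 h0.ne')] at h1
      rw [sub_add_cancel] at h1
      have h2 : ((cnt (i - 1)).card : ℝ) ≤ Δ := by
        exact_mod_cast (Finset.card_filter_le _ _).trans hXΔ
      linarith
    obtain ⟨j, hj, t, hmt, htB, hcard⟩ := hU i a h0 (by omega) hix
      (fun v => by
        by_cases h : v ∈ X ∧ s v ≤ s₀ + i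
        · simp only [a, if_pos h]; omega
        · simp only [a, if_neg h]; omega)
      (by rw [hacnt i le_rfl]; exact hspec)
      (fun j hj => by rw [hacnt j hj.le]; exact hmin j hj)
    refine ⟨(s₀ + j) * B + t, ?_, ?_, ?_⟩
    · change s₀ * B ≤ _
      rw [add_mul]; omega
    · change (s₀ + j) * B + t < s₀ * B + B * W
      have : (j + 1) * B ≤ W * B := Nat.mul_le_mul_right B (by omega)
      rw [add_one_mul] at this
      rw [add_mul, mul_comm B W]; omega
    · rw [← hcard]
      refine congrArg Finset.card (Finset.ext fun v => ?_)
      simp only [Finset.mem_filter, Finset.mem_univ, true_and]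
      change (v ∈ X ∧ s v * B ≤ (s₀ + j) * B + t ∧ _ ) ↔ _
      rw [hcol j t htB v, ha j hj.le v, and_assoc]
      refine and_congr_right fun hv => and_congr_right fun h2 => ?_
      have hav : a v = s v - s₀ := if_pos ⟨hv, by omega⟩
      have h4 : (s₀ + j) * B + t - blockStart B (ω v) = (j - a v) * B + t := by
        change (s₀ + j) * B + t - s v * B = _
        have h5 : s₀ + j = s v + (j - a v) := by have := hs₀le v hv; omega
        rw [h5, add_mul]; omega
      rw [h4, if_neg]
      rw [Nat.mul_add_mod', Nat.mod_eq_of_lt htB]; omega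

end Radio

/-! ### Histories and transmissions of the block algorithm -/

namespace Radio

variable {n : ℕ} {G : Digraph (Fin n)} {source : Fin n}

lemma Protocol.history_succ_ne_nil {P : Protocol n} {t : ℕ} {v : Fin n}
    (h : P.history G source t v ≠ []) : P.history G source (t + 1) v ≠ [] := by
  rw [Protocol.history]
  simp [h]

lemma Protocol.history_ne_nil_of_le {P : Protocol n} {s t : ℕ} (hst : s ≤ t) {v : Fin n}
    (h : P.history G source s v ≠ []) : P.history G source t v ≠ [] := by
  induction t, hst using Nat.le_induction with
  | base => exact h
  | succ t _ ih => exact Protocol.history_succ_ne_nil ih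

/-- A dormant node is woken when exactly one of its in-neighbours transmits. -/
lemma Protocol.history_succ_ne_nil_of_existsUnique {P : Protocol n} {t : ℕ} {v : Fin n}
    (h : ∃! u, G.Adj u v ∧ P.action u (P.history G source t u) ≠ none) :
    P.history G source (t + 1) v ≠ [] := by
  by_cases hv : P.history G source t v = []
  · rw [Protocol.history]
    have hr : receive G (fun u => P.action u (P.history G source t u)) v ≠ none := by
      have h' : P.action v (P.history G source t v) = none ∧
          ∃! u, G.Adj u v ∧ P.action u (P.history G source t u) ≠ none :=
        ⟨by simp [Protocol.action, hv], h⟩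
      rw [receive, dif_pos h']
      exact h'.2.choose_spec.1.2
    simp [hr]
  · exact Protocol.history_succ_ne_nil hv

variable {D B : ℕ} {S : Fin n → ℕ → Bool}

/-- An active node knows the time-step in which it became active and the current one. -/
lemma blockAlgorithm_history (t : ℕ) (v : Fin n)
    (hv : (blockAlgorithm n D B S).history G source t v ≠ []) :
    ∃ i ≤ t, ((blockAlgorithm n D B S).history G source t v).getLast? = some (some i) ∧
      ((blockAlgorithm n D B S).history G source t v).length + i = t + 1 ∧
      (blockAlgorithm n D B S).history G source i v ≠ [] ∧
      ∀ t' < i, (blockAlgorithm n D B S).history G source t' v = [] := by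
  induction t generalizing v with
  | zero =>
    refine ⟨0, le_rfl, ?_⟩
    rw [Protocol.history] at hv ⊢
    by_cases h : v = source
    · simp [h, blockAlgorithm]
    · simp [h] at hv
  | succ t ih =>
    set P := blockAlgorithm n D B S with hP
    by_cases hold : P.history G source t v = []
    · have hnew := hv
      rw [Protocol.history] at hnew
      set r := receive G (fun u => P.action u (P.history G source t u)) v with hr
      have hrn : r ≠ none := by
        intro h; apply hnew; simp [hold, h]
      have e : P.history G source (t + 1) v = [r] := by
        rw [Protocol.history]; simp [hold, ← hr, hrn]
      -- whoever woke `v` knew that its transmission took place in time-step `t`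
      have hrt : r = some (t + 1) := by
        rw [receive] at hr
        split_ifs at hr with hc
        · have hu := hc.2.choose_spec.1.2
          rw [← hr] at hu
          set u := hc.2.choose
          by_cases hu0 : P.history G source t u = []
          · exact absurd (by rw [hr]; simp [Protocol.action, hu0]) hrn
          obtain ⟨i, hi, h1, h2, -⟩ := ih u hu0
          rw [hr] at hrn ⊢
          simp only [Protocol.action, hu0, if_false] at hrn ⊢
          simp only [hP, blockAlgorithm] at hrn h1 h2 ⊢
          rw [h1] at hrn ⊢
          simp only at hrn ⊢
          split_ifs at hrn ⊢
          · congr 1; omega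
          · exact absurd rfl hrn
        · exact absurd hr hrn
      refine ⟨t + 1, le_rfl, by simp [e, hrt], by simp [e, add_comm], hv, fun t' ht' => ?_⟩
      by_contra h
      exact Protocol.history_ne_nil_of_le (Nat.lt_succ_iff.1 ht') h hold
    · obtain ⟨i, hi, h1, h2, h3, h4⟩ := ih v hold
      obtain ⟨x, hx⟩ : ∃ x, P.history G source (t + 1) v = x :: P.history G source t v := by
        conv in P.history G source (t + 1) v => rw [Protocol.history]
        simp [hold]
      refine ⟨i, by omega, ?_, ?_, h3, h4⟩
      · rw [hx, List.getLast?_cons_of_ne_nil hold, h1]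
      · rw [hx, List.length_cons]; omega

/-- When the nodes of the block algorithm transmit, in terms of their activation times. -/
lemma blockAlgorithm_action_ne_none_iff {t i : ℕ} {v : Fin n} (hit : i ≤ t)
    (hi : (blockAlgorithm n D B S).history G source i v ≠ [])
    (hi' : ∀ t' < i, (blockAlgorithm n D B S).history G source t' v = []) :
    (blockAlgorithm n D B S).action v ((blockAlgorithm n D B S).history G source t v) ≠ none ↔
      blockStart B i ≤ t ∧ t < blockStart B i + D * B ∧ S v (t - blockStart B i) = true := by
  have hv := Protocol.history_ne_nil_of_le hit hi
  obtain ⟨j, -, h1, h2, h3, h4⟩ := blockAlgorithm_history t v hv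
  obtain rfl : j = i := by
    rcases lt_trichotomy j i with h | h | h
    · exact absurd (hi' j h) h3
    · exact h
    · exact absurd (h4 i h) hi
  set h := (blockAlgorithm n D B S).history G source t v
  have e : j + (h.length - 1) = t := by omega
  simp only [Protocol.action, hv, if_false]
  simp only [blockAlgorithm, h1, e]
  simp

lemma le_blockStart (hB : 0 < B) (x : ℕ) : x ≤ blockStart B x := by
  have := le_smul_ceilDiv (b := x) hB
  rw [blockStart, mul_comm]; simpa using this

lemma blockStart_le (hB : 0 < B) (x : ℕ) : blockStart B x ≤ x + B := by
  rw [blockStart, Nat.ceilDiv_eq_add_pred_div]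
  exact (Nat.div_mul_le_self _ _).trans (by omega)

lemma blockStart_mono (hB : 0 < B) : Monotone (blockStart B) := fun _ _ h =>
  Nat.mul_le_mul_right B ((gc_mul_ceilDiv hB).monotone_l h)

lemma blockStart_mul (hB : 0 < B) (d : ℕ) : blockStart B (d * B) = d * B := by
  refine le_antisymm (Nat.mul_le_mul_right B ?_) (le_blockStart hB _)
  rw [ceilDiv_le_iff_le_mul hB, mul_comm]

end Radio

/-! ### Progress of the block algorithm -/

namespace Radio

variable {n : ℕ} {G : Digraph (Fin n)} {source : Fin n}

/-- The time-step in which `v` becomes active, or `M` if `v` is dormant before time-step `M`. -/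
noncomputable def wakeTime (P : Protocol n) (G : Digraph (Fin n)) (source : Fin n) (M : ℕ)
    (v : Fin n) : ℕ :=
  sInf {t | P.history G source t v ≠ [] ∨ t = M}

lemma wakeTime_le {P : Protocol n} {M t : ℕ} {v : Fin n}
    (h : P.history G source t v ≠ []) : wakeTime P G source M v ≤ t :=
  Nat.sInf_le (Or.inl h)

lemma history_of_lt_wakeTime {P : Protocol n} {M t : ℕ} {v : Fin n}
    (h : t < wakeTime P G source M v) : P.history G source t v = [] := by
  by_contra hc
  exact absurd (wakeTime_le hc) (not_le.2 h)

lemma history_wakeTime_ne_nil {P : Protocol n} {M : ℕ} {v : Fin n}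
    (h : wakeTime P G source M v < M) :
    P.history G source (wakeTime P G source M v) v ≠ [] :=
  (Nat.sInf_mem (s := {t | P.history G source t v ≠ [] ∨ t = M}) ⟨M, Or.inr rfl⟩).resolve_right
    h.ne

variable {D Δ B : ℕ} {S : Fin n → ℕ → Bool}

lemma blockAlgorithm_action_iff_wakeTime (hB : 0 < B) {M j : ℕ} (hj : j < M) (v : Fin n) :
    (blockAlgorithm n D B S).action v ((blockAlgorithm n D B S).history G source j v) ≠ none ↔
      blockStart B (wakeTime (blockAlgorithm n D B S) G source M v) ≤ j ∧
      j < blockStart B (wakeTime (blockAlgorithm n D B S) G source M v) + D * B ∧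
      S v (j - blockStart B (wakeTime (blockAlgorithm n D B S) G source M v)) = true := by
  set P := blockAlgorithm n D B S with hP
  have hw := le_blockStart hB (wakeTime P G source M v)
  rcases lt_or_ge j (wakeTime P G source M v) with h | h
  · have := history_of_lt_wakeTime h
    refine iff_of_false (by simp [Protocol.action, this]) fun h' => ?_
    omega
  · exact blockAlgorithm_action_ne_none_iff h (history_wakeTime_ne_nil (h.trans_lt hj))
      fun t' ht' => history_of_lt_wakeTime ht'

lemma existsUnique_of_card_filter_eq_one {α : Type*} {p q : α → Prop} (X : Finset α)
    [DecidablePred q] (h : (X.filter q).card = 1) (hp : ∀ a, p a ↔ a ∈ X ∧ q a) : ∃! a, p a := by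
  obtain ⟨a, ha⟩ := Finset.card_eq_one.1 h
  have ha' : ∀ b, p b ↔ b = a := fun b => by
    rw [hp, ← Finset.mem_filter, ha, Finset.mem_singleton]
  exact ⟨a, (ha' a).2 rfl, fun b hb => (ha' b).1 hb⟩

lemma card_inNeighbours_le {Δ : ℕ} (hΔ : maxInDegree G ≤ Δ) (v : Fin n) (X : Finset (Fin n))
    (hX : ∀ u ∈ X, G.Adj u v) : X.card ≤ Δ := by
  have h1 : X.card ≤ inDegree G v := by
    rw [inDegree, ← Set.ncard_coe_finset]
    exact Set.ncard_le_ncard (fun u hu => hX u hu) (Set.toFinite _)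
  exact h1.trans ((Finset.le_sup (f := inDegree G) (Finset.mem_univ v)).trans hΔ)

/-- If every node repeats a selective family, then each layer is informed within one period. -/
theorem blockAlgorithm_selective_history (hB : 0 < B) {F : Fin n → ℕ → Bool}
    (hF : IsSelective n Δ B F) (hΔ : maxInDegree G ≤ Δ) {d : ℕ} (hd : d ≤ D) {v : Fin n}
    (hv : HasWalk G d source v) :
    (blockAlgorithm n D B fun v k => F v (k % B)).history G source (d * B) v ≠ [] := by
  classical
  induction d generalizing v with
  | zero =>
    obtain rfl : source = v := hv
    simp [Protocol.history]
  | succ d ih =>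
    obtain ⟨w, hw, hwv⟩ := hv
    set P := blockAlgorithm n D B fun v k => F v (k % B) with hP
    set X : Finset (Fin n) :=
      Finset.univ.filter fun u => G.Adj u v ∧ P.history G source (d * B) u ≠ [] with hX
    obtain ⟨t, ht, hcard⟩ := hF X ⟨w, by simp [hX, hwv, ih (by omega) hw]⟩ (by
      exact_mod_cast card_inNeighbours_le hΔ v X fun u hu => (Finset.mem_filter.1 hu).2.1)
    have hM : d * B + t < (d + 1) * B := by rw [add_one_mul]; omega
    have hDB : (d + 1) * B ≤ D * B := Nat.mul_le_mul_right B hd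
    refine Protocol.history_ne_nil_of_le (s := d * B + t + 1) hM
      (Protocol.history_succ_ne_nil_of_existsUnique
        (existsUnique_of_card_filter_eq_one X hcard fun u => ?_))
    rw [blockAlgorithm_action_iff_wakeTime hB hM u, hX]
    simp only [Finset.mem_filter, Finset.mem_univ, true_and, and_assoc]
    refine and_congr_right fun _ => ?_
    -- the nodes that take part in this period are those active at its beginning
    have hstart : blockStart B (wakeTime P G source ((d + 1) * B) u) ≤ d * B + t ↔
        wakeTime P G source ((d + 1) * B) u ≤ d * B := by
      constructor
      · intro h
        have h1 := h.trans_lt hM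
        rw [blockStart] at h1
        have h2 := Nat.lt_succ_iff.1 (Nat.lt_of_mul_lt_mul_right h1)
        exact (le_blockStart hB _).trans (Nat.mul_le_mul_right B h2)
      · intro h
        have := blockStart_mono hB h
        rw [blockStart_mul hB] at this
        omega
    have hact : wakeTime P G source ((d + 1) * B) u ≤ d * B ↔
        P.history G source (d * B) u ≠ [] := by
      refine ⟨fun h => Protocol.history_ne_nil_of_le h (history_wakeTime_ne_nil ?_), wakeTime_le⟩
      exact h.trans_lt ((Nat.le_add_right _ _).trans_lt hM)
    rw [← hact, ← hstart]
    refine and_congr_right fun h => ?_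
    have h1 : (d * B + t - blockStart B (wakeTime P G source ((d + 1) * B) u)) % B = t := by
      have h2 := blockStart_mono hB (hstart.1 h)
      rw [blockStart_mul hB, blockStart] at h2
      rw [blockStart]
      set b := wakeTime P G source ((d + 1) * B) u ⌈/⌉ B
      obtain ⟨k, hk⟩ := Nat.exists_eq_add_of_le (Nat.le_of_mul_le_mul_right h2 hB)
      clear_value b
      rw [hk, add_mul, add_assoc, Nat.add_sub_cancel_left, Nat.mul_add_mod',
        Nat.mod_eq_of_lt ht]
    rw [h1]
    exact and_iff_right (by omega)

lemma exists_path {d : ℕ} {v : Fin n} (h : HasWalk G d source v) :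
    ∃ p : ℕ → Fin n, p 0 = source ∧ p d = v ∧ ∀ i < d, G.Adj (p i) (p (i + 1)) := by
  induction d generalizing v with
  | zero => exact ⟨fun _ => source, rfl, h, by simp⟩
  | succ d ih =>
    obtain ⟨w, hw, hwv⟩ := h
    obtain ⟨p, h0, hd, hp⟩ := ih hw
    refine ⟨fun i => if i ≤ d then p i else v, by simp [h0], by simp, fun i hi => ?_⟩
    rcases Nat.lt_succ_iff_lt_or_eq.1 hi with h | rfl
    · simpa [h.le, Nat.succ_le_iff.2 h] using hp i h
    · simpa [hd] using hwv

open Classical in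
/-- The nodes whose last out-neighbour on the path `p 0, …, p d` is `p l`. -/
noncomputable def lastInto (G : Digraph (Fin n)) (p : ℕ → Fin n) (d l : ℕ) : Finset (Fin n) :=
  Finset.univ.filter fun u => G.Adj u (p l) ∧ ∀ l', l < l' → l' ≤ d → ¬ G.Adj u (p l')

lemma mem_lastInto {p : ℕ → Fin n} {d l : ℕ} {u : Fin n} :
    u ∈ lastInto G p d l ↔ G.Adj u (p l) ∧ ∀ l', l < l' → l' ≤ d → ¬ G.Adj u (p l') := by
  simp [lastInto]

lemma exists_mem_lastInto {p : ℕ → Fin n} {d l : ℕ} (hl : l ≤ d) {u : Fin n}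
    (h : G.Adj u (p l)) : ∃ l', l ≤ l' ∧ l' ≤ d ∧ u ∈ lastInto G p d l' := by
  classical
  refine ⟨Nat.findGreatest (fun k => G.Adj u (p k)) d, Nat.le_findGreatest hl h,
    Nat.findGreatest_le d,
    mem_lastInto.2 ⟨Nat.findGreatest_spec (P := fun k => G.Adj u (p k)) hl h, fun l' h1 h2 => ?_⟩⟩
  exact Nat.findGreatest_is_greatest h1 h2

lemma sum_card_lastInto_le (p : ℕ → Fin n) (d : ℕ) :
    ∑ l ∈ Finset.Ico 1 (d + 1), (lastInto G p d l).card ≤ n := by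
  classical
  rw [← Finset.card_biUnion]
  · simpa using Finset.card_le_univ ((Finset.Ico 1 (d + 1)).biUnion fun l => lastInto G p d l)
  · intro l hl l' hl' hne
    refine Finset.disjoint_left.2 fun u h1 h2 => ?_
    rw [mem_lastInto] at h1 h2
    simp only [Finset.coe_Ico, Set.mem_Ico] at hl hl'
    rcases lt_or_gt_of_ne hne with h | h
    · exact h1.2 l' h (by omega) h2.1
    · exact h2.2 l h (by omega) h1.1

/-- Along a path `p 0, …, p d` from the source, `X l = lastInto G p d l` is a partition of the
in-neighbours of `p 1, …, p d`.  If `X m` has an active node and no `X l` with `l > m` does, then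
`p m` hears exactly the transmissions from `X m`, so it is informed within the window of `X m`, and
it belongs to a later set itself.  The windows have a total length of at most
`∑ l, B (⌈|X l| / r⌉ + 1) ≤ B (n / r + 2 D) = 3 D B`. -/
theorem blockAlgorithm_synchronizer_history (hB : 0 < B) (hD : 1 ≤ D) (hDn : D ≤ n)
    (hS : IsBlockSynchronizer n Δ ((n : ℝ) / D) B S) (hΔ : maxInDegree G ≤ Δ) {d : ℕ}
    (hd : d ≤ D) {v : Fin n} (hv : HasWalk G d source v) :
    (blockAlgorithm n D B S).history G source (3 * (D * B)) v ≠ [] := by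
  classical
  set P := blockAlgorithm n D B S with hP
  obtain ⟨p, hp0, hpd, hp⟩ := exists_path hv
  have hD0 : (0 : ℝ) < D := by exact_mod_cast hD
  have hn0 : (0 : ℝ) < n := by exact_mod_cast hD.trans hDn
  set r : ℝ := (n : ℝ) / D with hr
  have hr0 : 0 < r := by positivity
  set X : ℕ → Finset (Fin n) := fun l => lastInto G p d l with hX
  set cost : ℕ → ℕ := fun l => B * ⌈((X l).card : ℝ) / r⌉₊ + B with hcost
  -- after the first `m - 1` windows the front is at `m` or later, or `v` is active
  have key : ∀ m, 1 ≤ m → m ≤ d + 1 →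
      (∃ l, m ≤ l ∧ l ≤ d ∧ ∃ u ∈ X l, P.history G source (∑ l ∈ Finset.Ico 1 m, cost l) u ≠ []) ∨
        P.history G source (∑ l ∈ Finset.Ico 1 m, cost l) v ≠ [] := by
    intro m hm
    induction m, hm using Nat.le_induction with
    | base =>
      intro _
      have hs : P.history G source 0 source ≠ [] := by simp [Protocol.history]
      simp only [Finset.Ico_self, Finset.sum_empty]
      rcases Nat.eq_zero_or_pos d with h0 | h0
      · right; rw [← hpd, h0, hp0]; exact hs
      · left
        have := hp 0 h0
        rw [hp0] at this
        obtain ⟨l, h1, h2, h3⟩ := exists_mem_lastInto (G := G) (p := p) (d := d) h0 this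
        exact ⟨l, h1, h2, source, h3, hs⟩
    | succ m hm ih =>
      intro hmd
      rw [Finset.sum_Ico_succ_top hm]
      set τ := ∑ l ∈ Finset.Ico 1 m, cost l with hτ
      rcases ih (by omega) with ⟨l, hml, hld, u, hu, huact⟩ | h
      swap
      · exact Or.inr (Protocol.history_ne_nil_of_le (Nat.le_add_right _ _) h)
      rcases Nat.lt_or_ge m l with h | h
      · exact Or.inl ⟨l, h, hld, u, hu,
          Protocol.history_ne_nil_of_le (Nat.le_add_right _ _) huact⟩
      obtain rfl : m = l := le_antisymm hml h
      by_contra! hcon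
      obtain ⟨hfront, hvdorm⟩ := hcon
      set M := τ + cost m with hM
      obtain ⟨j, hj1, hj2, hj3⟩ := hS (wakeTime P G source M) (X m) ⟨u, hu⟩
        (card_inNeighbours_le hΔ (p m) _ fun u hu => (mem_lastInto.1 hu).1)
      set s₀ := blockStart B ((X m).inf' ⟨u, hu⟩ (wakeTime P G source M)) with hs₀
      have hs₀τ : s₀ ≤ τ + B :=
        (blockStart_mono hB ((Finset.inf'_le _ hu).trans (wakeTime_le huact))).trans
          (blockStart_le hB τ)
      have hjM : j < M := by simp only [hM, hcost]; omega
      have hceil : B * ⌈((X m).card : ℝ) / r⌉₊ ≤ D * B := by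
        rw [mul_comm]
        refine Nat.mul_le_mul_right B (Nat.ceil_le.2 ?_)
        rw [div_le_iff₀ hr0, hr, mul_div_cancel₀ _ hD0.ne']
        exact_mod_cast (Finset.card_le_univ (X m)).trans (by simp)
      have hpm : P.history G source (j + 1) (p m) ≠ [] := by
        refine Protocol.history_succ_ne_nil_of_existsUnique
          (existsUnique_of_card_filter_eq_one (X m) hj3 fun w => ?_)
        have hwX : (G.Adj w (p m) ∧ P.action w (P.history G source j w) ≠ none) →
            w ∈ X m := by
          rintro ⟨hw, hact⟩
          obtain ⟨l, h1, h2, h3⟩ := exists_mem_lastInto (G := G) (p := p) (d := d) hld hw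
          rcases Nat.lt_or_ge m l with h4 | h4
          · have hwact : P.history G source j w ≠ [] := fun h0 => hact (by
              simp [Protocol.action, h0])
            exact absurd (hfront l h4 h2 w h3) (Protocol.history_ne_nil_of_le hjM.le hwact)
          · rwa [le_antisymm h4 h1] at h3
        have hiff := blockAlgorithm_action_iff_wakeTime (S := S) (D := D) (G := G)
          (source := source) hB hjM w
        rw [← hP] at hiff
        constructor
        · intro h
          obtain ⟨h1, h2, h3⟩ := hiff.1 h.2
          exact ⟨hwX h, h1, h3⟩
        · rintro ⟨hwm, h1, h3⟩
          refine ⟨(mem_lastInto.1 hwm).1, hiff.2 ⟨h1, ?_, h3⟩⟩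
          have h4 : s₀ ≤ blockStart B (wakeTime P G source M w) :=
            blockStart_mono hB (Finset.inf'_le _ hwm)
          omega
      have hpmM := Protocol.history_ne_nil_of_le (Nat.succ_le_iff.2 hjM) hpm
      rcases Nat.lt_or_ge m d with h | h
      · obtain ⟨l, h1, h2, h3⟩ := exists_mem_lastInto (G := G) (p := p) (d := d) h (hp m h)
        exact hpmM (hfront l h1 h2 _ h3)
      · rw [le_antisymm hld h, hpd] at hpmM
        exact hpmM hvdorm
  rcases key (d + 1) (by omega) le_rfl with ⟨l, h1, h2, -⟩ | h
  · omega
  refine Protocol.history_ne_nil_of_le ?_ h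
  have hreal : ((∑ l ∈ Finset.Ico 1 (d + 1), cost l : ℕ) : ℝ) ≤ 3 * (D * B) := by
    have h1 : ∀ l ∈ Finset.Ico 1 (d + 1), (cost l : ℝ) ≤ B / r * (X l).card + 2 * B := by
      intro l _
      have := (Nat.ceil_lt_add_one (a := ((X l).card : ℝ) / r) (by positivity)).le
      simp only [hcost]
      push_cast
      calc (B : ℝ) * ⌈((X l).card : ℝ) / r⌉₊ + B ≤ B * (((X l).card : ℝ) / r + 1) + B := by gcongr
        _ = _ := by ring
    have h2 : ((∑ l ∈ Finset.Ico 1 (d + 1), (X l).card : ℕ) : ℝ) ≤ n := by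
      exact_mod_cast sum_card_lastInto_le p d
    push_cast at h2 ⊢
    have hdD : (d : ℝ) ≤ D := by exact_mod_cast hd
    calc ∑ l ∈ Finset.Ico 1 (d + 1), (cost l : ℝ)
        ≤ ∑ l ∈ Finset.Ico 1 (d + 1), (B / r * (X l).card + 2 * B) := Finset.sum_le_sum h1
      _ = B / r * ∑ l ∈ Finset.Ico 1 (d + 1), ((X l).card : ℝ) + d * (2 * B) := by
          rw [Finset.sum_add_distrib, ← Finset.mul_sum, Finset.sum_const, Nat.card_Ico,
            nsmul_eq_mul]; simp
      _ ≤ B / r * n + D * (2 * B) := by gcongr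
      _ = 3 * (D * B) := by rw [hr]; field_simp; ring
  exact_mod_cast hreal

end Radio

/-! ### Logarithms and constants -/

lemma one_le_lg (x : ℝ) : 1 ≤ lg x := le_max_left _ _

lemma one_add_log_le_two_mul_lg {x : ℝ} (hx : 1 ≤ x) : 1 + Real.log x ≤ 2 * lg x := by
  have h1 : Real.log x ≤ Real.logb 2 x := by
    rw [Real.logb, le_div_iff₀ (Real.log_pos one_lt_two)]
    have := Real.log_two_lt_d9
    nlinarith [Real.log_nonneg hx]
  have h2 : Real.logb 2 x ≤ lg x := le_max_right _ _
  linarith [one_le_lg x]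

/-- The number of dyadic scales: enough for loads up to `8 lg x`, yet `O(lg lg x)`. -/
lemma exists_two_pow_ge_lg (x : ℝ) :
    ∃ Q : ℕ, 16 * lg x ≤ 2 ^ Q ∧ (Q : ℝ) ≤ 6 * lg (lg x) := by
  have h0 : 0 < lg x := one_pos.trans_le (one_le_lg x)
  have h1 : 0 ≤ Real.logb 2 (lg x) := Real.logb_nonneg one_lt_two (one_le_lg x)
  refine ⟨4 + ⌈Real.logb 2 (lg x)⌉₊, ?_, ?_⟩
  · have h2 : lg x ≤ 2 ^ ⌈Real.logb 2 (lg x)⌉₊ := by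
      rw [← Real.rpow_natCast, ← Real.logb_le_iff_le_rpow one_lt_two h0]
      exact Nat.le_ceil _
    rw [pow_add]; linarith
  · have h2 := Nat.ceil_lt_add_one h1
    have h3 : Real.logb 2 (lg x) ≤ lg (lg x) := le_max_right _ _
    push_cast
    linarith [one_le_lg (lg x)]

/-- The running time of the selective-family algorithm is at most that of the block
synchronizer algorithm (up to constants). -/
lemma mul_lg_div_le {n D Δ : ℕ} (hD : 1 ≤ D) (hΔ : 1 ≤ Δ) (h : D * Δ ≤ n) :
    (D : ℝ) * Δ * lg (n / Δ) ≤ 3 * (n * lg D) := by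
  have hD0 : (1 : ℝ) ≤ D := by exact_mod_cast hD
  have hΔ0 : (1 : ℝ) ≤ Δ := by exact_mod_cast hΔ
  have hle : (D : ℝ) * Δ ≤ n := by exact_mod_cast h
  have hpos : 0 < (D : ℝ) * Δ := by positivity
  have hn0 : (0 : ℝ) < n := hpos.trans_le hle
  have h1 : Real.logb 2 (n / Δ) ≤ lg D + 2 * (n / (D * Δ)) := by
    have e : (n : ℝ) / Δ = D * (n / (D * Δ)) := by field_simp
    rw [e, Real.logb_mul (by positivity) (by positivity)]
    refine add_le_add (le_max_right _ _) ?_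
    rw [Real.logb, div_le_iff₀ (Real.log_pos one_lt_two)]
    have h2 := Real.log_le_sub_one_of_pos (x := (n : ℝ) / (D * Δ)) (by positivity)
    have h3 := Real.log_two_gt_d9
    have h4 : (0 : ℝ) < n / (D * Δ) := by positivity
    nlinarith
  have h2 : lg (n / Δ) ≤ lg D + 2 * (n / (D * Δ)) :=
    max_le (by have : (0 : ℝ) < n / (D * Δ) := by positivity
               linarith [one_le_lg D]) h1
  calc (D : ℝ) * Δ * lg (n / Δ) ≤ D * Δ * (lg D + 2 * (n / (D * Δ))) := by gcongr
    _ = D * Δ * lg D + 2 * n := by field_simp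
    _ ≤ n * lg D + 2 * (n * lg D) := by
        have := one_le_lg D
        gcongr
        nlinarith
    _ = _ := by ring

/-! ### Existence of synchronizers of the required block length, and running times -/

namespace Radio

lemma blockLength_pos {n D Δ : ℕ} (hD : 1 ≤ D) (hDn : D ≤ n) : 0 < blockLength 708 n D Δ := by
  have hD0 : (0 : ℝ) < D := by exact_mod_cast hD
  have hn0 : (0 : ℝ) < n := by exact_mod_cast hD.trans hDn
  have h1 := one_pos.trans_le (one_le_lg D)
  have h2 := one_pos.trans_le (one_le_lg (lg ((D : ℝ) * Δ / n)))
  exact Nat.ceil_pos.2 (by positivity)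

lemma mul_blockLength_le {n D Δ : ℕ} (hD : 1 ≤ D) (hDn : D ≤ n) :
    (D : ℝ) * blockLength 708 n D Δ ≤ 709 * (n * lg D * lg (lg ((D : ℝ) * Δ / n))) := by
  have hD0 : (1 : ℝ) ≤ D := by exact_mod_cast hD
  have hDn' : (D : ℝ) ≤ n := by exact_mod_cast hDn
  have hn0 : (0 : ℝ) < n := by linarith
  have h1 := one_le_lg D
  have h2 := one_le_lg (lg ((D : ℝ) * Δ / n))
  set a := lg D
  set b := lg (lg ((D : ℝ) * Δ / n)) with hb
  have h3 : (blockLength 708 n D Δ : ℝ) ≤ 708 * (n / D) * a * b + 1 :=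
    (Nat.ceil_lt_add_one (by positivity)).le
  have h4 : (D : ℝ) ≤ n * a * b :=
    calc (D : ℝ) ≤ n * 1 * 1 := by linarith
      _ ≤ n * a * b := by gcongr
  calc (D : ℝ) * blockLength 708 n D Δ ≤ D * (708 * (n / D) * a * b + 1) := by gcongr
    _ = 708 * (n * a * b) + D := by field_simp
    _ ≤ _ := by linarith

theorem exists_isBlockSynchronizer_blockLength {n D Δ : ℕ} (hDn : D ≤ n) (h : n < D * Δ) :
    ∃ S : Fin n → ℕ → Bool,
      IsBlockSynchronizer n Δ ((n : ℝ) / D) (blockLength 708 n D Δ) S := by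
  have hD : 1 ≤ D := Nat.pos_of_ne_zero (by rintro rfl; simp at h)
  have hD0 : (1 : ℝ) ≤ D := by exact_mod_cast hD
  have hDn' : (D : ℝ) ≤ n := by exact_mod_cast hDn
  have hn0 : (0 : ℝ) < n := by linarith
  set r : ℝ := (n : ℝ) / D with hr
  have hr1 : 1 ≤ r := (one_le_div (by linarith)).2 hDn'
  have hrn : r ≤ n := div_le_self hn0.le hD0
  have hx : (Δ : ℝ) / r = D * Δ / n := by rw [hr]; field_simp
  have hnr : (n : ℝ) / r = D := by rw [hr]; field_simp
  obtain ⟨m, F, hm, hF⟩ := exists_isSelective n (x := r) (by linarith) hrn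
  rw [hnr] at hm
  obtain ⟨Q, hQ, hQ'⟩ := exists_two_pow_ge_lg ((D : ℝ) * Δ / n)
  set N : ℕ := ⌈48 * (r * (1 + Real.log D))⌉₊ with hN
  -- `m ≤ 120 r lg D` places for the selective family and `Q N ≤ 588 r lg D lg (lg (Δ / r))` random
  -- ones fit into a block
  refine exists_isBlockSynchronizer (N := N) (Q := Q) (m := m) hD hDn hF
    (blockLength_pos hD hDn) ?_ (Nat.le_ceil _) ?_
  · have h1 := one_le_lg D
    have h2 := one_le_lg (lg ((D : ℝ) * Δ / n))
    have h3 := one_add_log_le_two_mul_lg hD0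
    have hlog : 0 ≤ Real.log D := Real.log_nonneg hD0
    have h4 : (N : ℝ) ≤ 49 * (r * (1 + Real.log D)) := by
      have := (Nat.ceil_lt_add_one (a := 48 * (r * (1 + Real.log D))) (by positivity)).le
      nlinarith
    have h5 : ((m + Q * N : ℕ) : ℝ) ≤ 708 * r * lg D * lg (lg ((D : ℝ) * Δ / n)) := by
      set a := lg D
      set b := lg (lg ((D : ℝ) * Δ / n))
      push_cast
      calc (m : ℝ) + Q * N ≤ 60 * (r * (2 * a)) + (6 * b) * (49 * (r * (2 * a))) := by
            gcongr
            · exact hm.trans (by gcongr)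
            · exact h4.trans (by gcongr)
        _ = 120 * (r * a) * 1 + 588 * (r * a) * b := by ring
        _ ≤ 120 * (r * a) * b + 588 * (r * a) * b := by gcongr
        _ = _ := by ring
    have h6 : ((m + Q * N : ℕ) : ℝ) ≤ blockLength 708 n D Δ := h5.trans (Nat.le_ceil _)
    exact Nat.cast_le.1 h6
  · intro i hi hix
    rw [hx] at hix
    have hi1 : (1 : ℝ) ≤ i := by exact_mod_cast hi
    have h1 : Real.log i ≤ Real.log ((D : ℝ) * Δ / n) := Real.log_le_log (by linarith) hix
    have h2 := one_add_log_le_two_mul_lg (hi1.trans hix)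
    linarith

lemma exists_hasWalk_le {n D Δ : ℕ} {G : Digraph (Fin n)} {source : Fin n}
    (h : IsNetwork G source D Δ) (v : Fin n) : ∃ d ≤ D, HasWalk G d source v :=
  ⟨dist G source v, h.ecc_eq ▸ Finset.le_sup (f := dist G source) (Finset.mem_univ v),
    Nat.sInf_mem (h.reachable v)⟩

/-- Without edges, or with eccentricity `0`, the source is the only node. -/
lemma IsNetwork.eq_source {n D Δ : ℕ} {G : Digraph (Fin n)} {source : Fin n}
    (h : IsNetwork G source D Δ) (h0 : D = 0 ∨ Δ = 0) (v : Fin n) : v = source := by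
  obtain ⟨d, hd, hw⟩ := exists_hasWalk_le h v
  cases d with
  | zero => exact hw.symm
  | succ d =>
    obtain ⟨w, -, hwv⟩ := hw
    have := card_inNeighbours_le h.maxInDegree_eq.le v {w} (by simpa using hwv)
    rw [Finset.card_singleton] at this
    omega

/-- The block algorithm with a periodically repeated selective family for in-neighbourhoods as its
sequences informs one layer of the network after the other. -/
theorem exists_protocol_of_mul_le {n D Δ : ℕ} (h : D * Δ ≤ n) :
    ∃ P : Protocol n, ∀ (G : Digraph (Fin n)) (source : Fin n), IsNetwork G source D Δ →
      P.BroadcastsWithin G source (122 * (D * Δ * lg ((n : ℝ) / Δ))) := by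
  by_cases h0 : D = 0 ∨ Δ = 0
  · -- the source is the only node
    refine ⟨⟨0, fun _ _ => none⟩, fun G source hG => ⟨0, ?_, fun v => ?_⟩⟩
    · have := one_pos.trans_le (one_le_lg ((n : ℝ) / Δ))
      push_cast; positivity
    · simp [Protocol.history, hG.eq_source h0 v]
  have hD : 1 ≤ D := by omega
  have hΔ : 1 ≤ Δ := by omega
  have hΔ0 : (1 : ℝ) ≤ Δ := by exact_mod_cast hΔ
  have hΔn : (Δ : ℝ) ≤ n := by exact_mod_cast (Nat.le_mul_of_pos_left Δ hD).trans h
  obtain ⟨m, F, hm, hF⟩ := exists_isSelective n (x := Δ) (by linarith) hΔn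
  -- `m + 1`, because a block must not be empty
  refine ⟨blockAlgorithm n D (m + 1) fun v k => F v (k % (m + 1)),
    fun G source hG => ⟨D * (m + 1), ?_, fun v => ?_⟩⟩
  · have h1 := one_add_log_le_two_mul_lg ((one_le_div (by linarith)).2 hΔn)
    have h2 : 0 ≤ Real.log ((n : ℝ) / Δ) :=
      Real.log_nonneg ((one_le_div (by linarith)).2 hΔn)
    have h3 : (m : ℝ) + 1 ≤ 61 * (Δ * (1 + Real.log ((n : ℝ) / Δ))) := by nlinarith
    push_cast
    calc (D : ℝ) * (m + 1) ≤ D * (61 * (Δ * (2 * lg ((n : ℝ) / Δ)))) := by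
          gcongr; exact h3.trans (by gcongr)
      _ = _ := by ring
  · obtain ⟨d, hd, hw⟩ := exists_hasWalk_le hG v
    have hF' : IsSelective n Δ (m + 1) F := fun X hX hc =>
      (hF X hX hc).imp fun t ht => ⟨ht.1.trans (Nat.lt_succ_self m), ht.2⟩
    exact Protocol.history_ne_nil_of_le (Nat.mul_le_mul_right _ hd)
      (blockAlgorithm_selective_history (Nat.succ_pos m) hF' hG.maxInDegree_eq.le hd hw)

lemma Protocol.BroadcastsWithin.mono {n : ℕ} {P : Protocol n} {G : Digraph (Fin n)}
    {source : Fin n} {b b' : ℝ} (h : P.BroadcastsWithin G source b) (hb : b ≤ b') :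
    P.BroadcastsWithin G source b' :=
  h.imp fun _ hT => ⟨hT.1.trans hb, hT.2⟩

end Radio

theorem theorem4 :
    ∃ c C : ℝ, 0 < c ∧ 0 < C ∧ ∀ n D Δ : ℕ,
      -- the block synchronizer algorithm, for `n < D Δ`
      (D ≤ n → Δ ≤ n → n < D * Δ →
        (∃ S : Fin n → ℕ → Bool,
          Radio.IsBlockSynchronizer n Δ ((n : ℝ) / D) (Radio.blockLength c n D Δ) S) ∧
        ∀ S : Fin n → ℕ → Bool,
          Radio.IsBlockSynchronizer n Δ ((n : ℝ) / D) (Radio.blockLength c n D Δ) S →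
          ∀ (G : Digraph (Fin n)) (source : Fin n), Radio.IsNetwork G source D Δ →
            (Radio.blockAlgorithm n D (Radio.blockLength c n D Δ) S).BroadcastsWithin G source
              (C * (n * lg D * lg (lg ((D : ℝ) * Δ / n))))) ∧
      -- the remaining case `D Δ ≤ n`
      (D * Δ ≤ n →
        ∃ P : Radio.Protocol n,
          ∀ (G : Digraph (Fin n)) (source : Fin n), Radio.IsNetwork G source D Δ →
            P.BroadcastsWithin G source (C * (D * Δ * lg ((n : ℝ) / Δ))) ∧
            P.BroadcastsWithin G source (C * (n * lg D * lg (lg ((D : ℝ) * Δ / n))))) := by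
  refine ⟨708, 3 * 709, by norm_num, by norm_num,
    fun n D Δ => ⟨fun hDn _ h => ⟨?_, ?_⟩, fun h => ?_⟩⟩
  · exact Radio.exists_isBlockSynchronizer_blockLength hDn h
  · intro S hS G source hG
    have hD : 1 ≤ D := Nat.pos_of_ne_zero (by rintro rfl; simp at h)
    refine ⟨3 * (D * Radio.blockLength 708 n D Δ), ?_, fun v => ?_⟩
    · have := Radio.mul_blockLength_le (Δ := Δ) hD hDn
      push_cast; linarith
    · obtain ⟨d, hd, hw⟩ := Radio.exists_hasWalk_le hG v
      exact Radio.blockAlgorithm_synchronizer_history (Radio.blockLength_pos hD hDn) hD hDn hS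
        hG.maxInDegree_eq.le hd hw
  · obtain ⟨P, hP⟩ := Radio.exists_protocol_of_mul_le h
    refine ⟨P, fun G source hG => ?_⟩
    have hlg := one_pos.trans_le (one_le_lg ((n : ℝ) / Δ))
    have hlgD := one_pos.trans_le (one_le_lg D)
    have hll := one_le_lg (lg ((D : ℝ) * Δ / n))
    refine ⟨(hP G source hG).mono (by gcongr; norm_num), ?_⟩
    by_cases h0 : D = 0 ∨ Δ = 0
    · -- both running times bound `0` steps
      refine (hP G source hG).mono (le_trans (b := 0) (le_of_eq ?_) (by positivity))
      rcases h0 with rfl | rfl <;> simp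
    · refine (hP G source hG).mono ?_
      have h1 := mul_lg_div_le (n := n) (D := D) (Δ := Δ) (by omega) (by omega) h
      have h2 : (n : ℝ) * lg D * 1 ≤ n * lg D * lg (lg ((D : ℝ) * Δ / n)) := by gcongr
      have h3 : (0 : ℝ) ≤ n * lg D := by positivity
      linarith
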